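/- Let $\Pi_n$ be an oriented polygon, drawn as a circle, with $n+1$ vertices $0,1,\dots,n$ in this cyclic order, the vertex $0$ being called the root; its sides are labelled $0,\dots,n$, the side $i$ going from the vertex $i$ to the vertex $i+1$ modulo $n+1$. A chord is a line joining two distinct vertices. A dissection diagram of degree $n$ is a set $D$ of $n$ chords of $\Pi_n$ which pairwise do not cross (they may share end points) and form an acyclic graph, hence a spanning tree of the vertices; each chord is directed towards the root. Let $\mathcal{D}$ be the free commutative unital $\mathbb{Q}$-algebra on the dissection diagrams of positive degree, graded by the degree; the dissection diagram of degree $0$ is identified with $1$. Let $D$ be a dissection diagram of degree $n$ and $C\subset D$ a set of its chords. The chords in $C$ cut $\Pi_n$ into $|C|+1$ faces $\alpha$. Let $\mathscr{S}_C(\alpha)$ be the set of sides of $\Pi_n$ that bound $\alpha$, and let $\mathscr{S}_C^+$ be the set of the sides of $\Pi_n$ that are not the minimum of the set $\mathscr{S}_C(\alpha)$ containing them. (a) For a face $\alpha$, contract the chords of $C$, and let $q_C^\alpha(D)$ be the set of images of the chords of $D\setminus C$ lying inside $\alpha$, in the polygon whose sides are those in $\mathscr{S}_C(\alpha)$, in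 increasing order, the smallest one starting at the root. Set $q_C(D)=\prod_\alpha q_C^\alpha(D)\in\mathcal{D}$. (b) Let $r_C(D)$ be obtained by keeping only the chords in $C$ and contracting the sides in $\mathscr{S}_C^+$; it is a set of chords in the polygon whose sides are those not in $\mathscr{S}_C^+$, in increasing order, the smallest one (the side $0$) starting at the root. (c) Let $k_C(D)$ be the number of chords $c\in C$ whose direction towards the root in $D$ differs from the direction towards the root of the image of $c$ in $r_C(D)$. Then every $q_C^\alpha(D)$ is a dissection diagram of degree $|\mathscr{S}_C(\alpha)|-1$, these degrees add up to $n-|C|$, and $r_C(D)$ is a dissection diagram of degree $|C|$. For $x\in\mathbb{Q}$ let $\Delta^{(x)}:\mathcal{D}\to\mathcal{D}\otimes\mathcal{D}$ be the morphism of algebras given on dissection diagrams by $$\Delta^{(x)}(D)=\sum_{C\subset D}x^{k_C(D)}\,q_C(D)\otimes r_C(D)\qquad(0^0=1).$$ The coproduct $\Delta=\Delta^{(-1)}$, that is $\Delta(D)=\sum_{C\subset D}(-1)^{k_C(D)}q_C(D)\otimes r_C(D)$, gives $\mathcal{D}$ the structure of a graded connected commutative Hopf algebra over $\mathbb{Q}$.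 More generally, so does $\Delta^{(x)}$ for every $x\in\mathbb{Q}$. -/

import Mathlib

open scoped TensorProduct

/-! # Dissection diagrams

The polygon `Π_n` has vertices `0, 1, …, n : Fin (n + 1)` in cyclic order, the root being `0`.
Its sides are also labelled by `Fin (n + 1)`: the side `i` goes from the vertex `i` to the vertex
`i + 1` (addition in `Fin (n + 1)`, so that the side `n` ends at the root); the root side is `0`.
A chord is an unordered pair of distinct vertices. -/

namespace Dissection

/-- The graph on the vertices of `Π_n` formed by a set of chords. -/
def chordGraph {n : ℕ} (K : Finset (Sym2 (Fin (n + 1)))) : SimpleGraph (Fin (n + 1)) :=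
  SimpleGraph.fromEdgeSet (K : Set (Sym2 (Fin (n + 1))))

/-- `K` is a set of `n` pairwise non-crossing chords of `Π_n` whose graph is acyclic.
Chords are allowed to share an end point. -/
structure IsDissection (n : ℕ) (K : Finset (Sym2 (Fin (n + 1)))) : Prop where
  loopless : ∀ c ∈ K, ¬ c.IsDiag
  card_eq : K.card = n
  acyclic : (chordGraph K).IsAcyclic
  noncrossing : ∀ a b c d : Fin (n + 1), a < b → b < c → c < d → s(a, c) ∈ K → s(b, d) ∉ K

/-- Dissection diagrams of degree `n`. -/
structure Diagram (n : ℕ) where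
  chords : Finset (Sym2 (Fin (n + 1)))
  isDissection : IsDissection n chords

/-- Dissection diagrams of positive degree; the degree is the first component. -/
abbrev PosDiagram : Type := {D : Σ n : ℕ, Diagram n // 0 < D.1}

/-- The free commutative unital `ℚ`-algebra on the dissection diagrams of positive degree. -/
abbrev DAlg : Type := MvPolynomial PosDiagram ℚ

/-- The grading of `DAlg` induced by the degrees of the dissection diagrams. -/
noncomputable def grading (n : ℕ) : Submodule ℚ DAlg :=
  MvPolynomial.weightedHomogeneousSubmodule ℚ (fun D : PosDiagram => D.1.1) n

/-- The element of `DAlg` given by a dissection diagram; the one of degree `0` is the unit. -/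
noncomputable def Diagram.toAlg {n : ℕ} (D : Diagram n) : DAlg :=
  if h : 0 < n then MvPolynomial.X ⟨⟨n, D⟩, h⟩ else 1

open Classical in
/-- The element of `DAlg` given by a set of chords that is a dissection diagram of degree `n`.
The value `0` on other sets of chords is never used: see the first part of the theorem. -/
noncomputable def chordsToAlg (n : ℕ) (K : Finset (Sym2 (Fin (n + 1)))) : DAlg :=
  if h : IsDissection n K then (Diagram.mk K h).toAlg else 0

/-! ## The faces cut out by a set `C` of chords -/

section Faces

variable {n : ℕ} (C : Finset (Sym2 (Fin (n + 1))))

/-- The sides `i` and `j` of `Π_n` are on the same side of every chord of `C`, i.e. they are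
sides of the same face of the planar graph formed by `C` and the polygon. (For `a < b` the sides
on one side of the chord `{a, b}` are `a, a + 1, …, b - 1`.) -/
def SameFace (i j : Fin (n + 1)) : Prop :=
  ∀ a b : Fin (n + 1), a < b → s(a, b) ∈ C → ((a ≤ i ∧ i < b) ↔ (a ≤ j ∧ j < b))

/-- The chord `c` (not in `C`) is inside the face that has `i` among its sides: it is on the same
side as `i` of every chord of `C`. -/
def ChordInFace (i : Fin (n + 1)) (c : Sym2 (Fin (n + 1))) : Prop :=
  ∀ a b : Fin (n + 1), a < b → s(a, b) ∈ C → ((a ≤ i ∧ i < b) ↔ ∀ v ∈ c, a ≤ v ∧ v ≤ b)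

open Classical in
/-- The set of those sides of the face containing the side `i` that are sides of `Π_n`. -/
noncomputable def face (i : Fin (n + 1)) : Finset (Fin (n + 1)) :=
  Finset.univ.filter (SameFace C i)

open Classical in
/-- The sides of `Π_n` that are minimal in their face; there is one for each face. -/
noncomputable def minSides : Finset (Fin (n + 1)) :=
  Finset.univ.filter fun i => ∀ j, SameFace C i j → i ≤ j

/-- The set `𝒮_C⁺` of the sides of `Π_n` that are not minimal in their face. -/
noncomputable def plusSides : Finset (Fin (n + 1)) := (minSides C)ᶜ

/-- The graph formed by the sides in `𝒮_C⁺`. -/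
noncomputable def plusGraph : SimpleGraph (Fin (n + 1)) :=
  SimpleGraph.fromEdgeSet {e | ∃ i ∈ plusSides C, e = s(i, i + 1)}

theorem face_card (i : Fin (n + 1)) : (face C i).card = ((face C i).card - 1) + 1 := by
  have h : i ∈ face C i := by simp [face, SameFace]
  have := Finset.card_pos.mpr ⟨i, h⟩
  omega

theorem minSides_card : (minSides C).card = ((minSides C).card - 1) + 1 := by
  have h : (0 : Fin (n + 1)) ∈ minSides C := by simp [minSides]
  have := Finset.card_pos.mpr ⟨_, h⟩
  omega

/-- The number `n(α)` for the face `α` containing the side `i`: it has `n(α) + 1` sides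
among the sides of `Π_n`. -/
noncomputable def faceDegree (i : Fin (n + 1)) : ℕ := (face C i).card - 1

/-- The number of faces minus one. -/
noncomputable def restDegree : ℕ := (minSides C).card - 1

/-- The sides of the face containing `i`, in increasing order. -/
noncomputable def faceSide (i : Fin (n + 1)) : Fin (faceDegree C i + 1) ↪o Fin (n + 1) :=
  (face C i).orderEmbOfFin (face_card C i)

/-- The sides that are minimal in their face, in increasing order. -/
noncomputable def minSide : Fin (restDegree C + 1) ↪o Fin (n + 1) :=
  (minSides C).orderEmbOfFin (minSides_card C)

end Faces

open Classical in
/-- Contraction. The edges of the graph `T` are contracted; `u 0 < u 1 < … < u m` are the sides of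
`Π_n` that become the sides of the new polygon `Π_m`. The vertex `j` of `Π_m` is the starting
vertex of its `j`-th side, hence the class of the vertex `u j` of `Π_n`. The chords of the result
are the images of the chords in `K`. -/
noncomputable def contract {n m : ℕ} (T : SimpleGraph (Fin (n + 1)))
    (u : Fin (m + 1) → Fin (n + 1)) (K : Finset (Sym2 (Fin (n + 1)))) :
    Finset (Sym2 (Fin (m + 1))) :=
  Finset.univ.filter fun c => ∃ (j k : Fin (m + 1)) (v w : Fin (n + 1)),
    c = s(j, k) ∧ s(v, w) ∈ K ∧ T.Reachable (u j) v ∧ T.Reachable (u k) w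

namespace Diagram

variable {n : ℕ} (D : Diagram n) (C : Finset (Sym2 (Fin (n + 1))))

open Classical in
/-- The set of chords of `q_C^α(D)`, for `α` the face containing the side `i`: among the chords of
`D` not in `C`, take those inside `α`, and contract the chords of `C`. -/
noncomputable def qChords (i : Fin (n + 1)) : Finset (Sym2 (Fin (faceDegree C i + 1))) :=
  contract (chordGraph C) (faceSide C i) ((D.chords \ C).filter (ChordInFace C i))

/-- The product `q_C(D)` of the `q_C^α(D)` over all faces `α`. -/
noncomputable def q : DAlg :=
  ∏ i ∈ minSides C, chordsToAlg (faceDegree C i) (D.qChords C i)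

end Diagram

section Rest

variable {n : ℕ} (C : Finset (Sym2 (Fin (n + 1))))

/-- The set of chords of `r_C(D)`: keep the chords in `C`, contract the sides in `𝒮_C⁺`. -/
noncomputable def rChords : Finset (Sym2 (Fin (restDegree C + 1))) :=
  contract (plusGraph C) (minSide C) C

/-- The element `r_C(D)`. -/
noncomputable def r : DAlg := chordsToAlg (restDegree C) (rChords C)

end Rest

/-- The chord `{v, w}` in `K`, oriented towards the root, goes from `v` to `w`. -/
def Directed {n : ℕ} (K : Finset (Sym2 (Fin (n + 1)))) (v w : Fin (n + 1)) : Prop :=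
  s(v, w) ∈ K ∧ (chordGraph K).dist w 0 < (chordGraph K).dist v 0

/-- The chords in `C` that are flipped in the process of computing `r_C(D)`, each of them
represented by the pair (start, end) for its direction in `D`. -/
def Diagram.flipped {n : ℕ} (D : Diagram n) (C : Finset (Sym2 (Fin (n + 1)))) :
    Set (Fin (n + 1) × Fin (n + 1)) :=
  {p | s(p.1, p.2) ∈ C ∧ Directed D.chords p.1 p.2 ∧
    ∃ j k : Fin (restDegree C + 1), (plusGraph C).Reachable (minSide C j) p.1 ∧
      (plusGraph C).Reachable (minSide C k) p.2 ∧ Directed (rChords C) k j}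

/-- The number `k_C(D)`. -/
noncomputable def Diagram.k {n : ℕ} (D : Diagram n) (C : Finset (Sym2 (Fin (n + 1)))) : ℕ :=
  (D.flipped C).ncard

/-- The morphism of algebras `Δ^{(x)}` given on dissection diagrams by
`Δ^{(x)}(D) = ∑_{C ⊆ 𝒞(D)} x ^ k_C(D) q_C(D) ⊗ r_C(D)`. -/
noncomputable def coproduct (x : ℚ) : DAlg →ₐ[ℚ] DAlg ⊗[ℚ] DAlg :=
  MvPolynomial.aeval fun D : PosDiagram =>
    ∑ C ∈ D.1.2.chords.powerset, (x ^ D.1.2.k C) • (D.1.2.q C ⊗ₜ[ℚ] r C)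

/-- The commutative algebra `A`, with the coproduct `Δ` and the grading `𝒜`, is a graded connected
Hopf algebra over `ℚ`. -/
def IsGradedConnectedHopfAlgebra {A : Type} [CommRing A] [Algebra ℚ A]
    (𝒜 : ℕ → Submodule ℚ A) (Δ : A →ₐ[ℚ] A ⊗[ℚ] A) : Prop :=
  -- `A` is a Hopf algebra with coproduct `Δ`, some counit `ε` and some antipode
  ∃ (ε : A →ₐ[ℚ] ℚ)
    (coassoc : (Algebra.TensorProduct.assoc ℚ ℚ ℚ A A A).toAlgHom.comp
      ((Algebra.TensorProduct.map Δ (AlgHom.id ℚ A)).comp Δ) =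
        (Algebra.TensorProduct.map (AlgHom.id ℚ A) Δ).comp Δ)
    (rTensor_counit : (Algebra.TensorProduct.map ε (AlgHom.id ℚ A)).comp Δ =
      (Algebra.TensorProduct.lid ℚ A).symm)
    (lTensor_counit : (Algebra.TensorProduct.map (AlgHom.id ℚ A) ε).comp Δ =
      (Algebra.TensorProduct.rid ℚ ℚ A).symm)
    (H : HopfAlgebra ℚ A),
    H.toBialgebra = Bialgebra.ofAlgHom Δ ε coassoc rTensor_counit lTensor_counit ∧
    -- multiplication and unit, coproduct, counit and antipode are compatible with the grading
    Nonempty (GradedAlgebra 𝒜) ∧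
    (∀ n, ∀ a ∈ 𝒜 n, Δ a ∈ ⨆ p ∈ Finset.HasAntidiagonal.antidiagonal n,
      LinearMap.range (TensorProduct.mapIncl (𝒜 p.1) (𝒜 p.2))) ∧
    (∀ n, n ≠ 0 → ∀ a ∈ 𝒜 n, ε a = 0) ∧
    (∀ n, ∀ a ∈ 𝒜 n, H.antipode a ∈ 𝒜 n) ∧
    -- connectedness
    𝒜 0 = Submodule.span ℚ {1}

end Dissection

/-! # The Hopf algebra of dissection diagrams

All diagrams occurring in an iterated coproduct of a diagram `D` are obtained from sets of chords of
`D` by the contraction of a set of sides. This makes coassociativity a statement about pairs of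
sets of chords `C ⊆ B ⊆ D`. -/

open scoped TensorProduct

namespace Dissection

/-! The whole argument is phrased in terms of which chords separate which sides. A set of `n`
loopless, pairwise non-crossing chords is a dissection exactly when every two sides are separated by
one of its chords, that is, when every face has only one side (`isDissection_iff`). If the sides
outside a set `S` are contracted (`proj`, `res`), separation of the sides in `S` is unchanged
(`sep_map_proj`), and a chord becomes a loop exactly when it is not `Essential`.

Separating the sides in `S` needs at least `|S| - 1` essential chords. For `C ⊆ D` this bound is
applied to `D` on each face of `C`, and to `C` on the set of minimal sides. A chord of `D` is
essential for at most one face, a chord of `C` for none, so the bounds add up to `n + 1 ≤ n + 1` and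
all of them are equalities (`counting`). Hence the factors of `q` and the diagram `r` are
contractions `res` of sets of chords of `D`, and they are dissections.

For the directions: removing a chord from a dissection merges two faces, with sides `i < j`. The
component that is cut off from the root consists of the vertices in `(i, j]`, so the end of the
chord in `(i, j]` is its source (`Src`). Such a witness survives the removal of other chords
(`Src.mono`), and for an upward chord it also survives the passage to the minimal sides of faces
(`up_minOn`). So a chord can only be flipped from downward to upward, hence at most once along `D ⊇
B ⊇ C`, and the numbers of flips add up (`kOn_add`). This is why every value of `x` is allowed, not
only `-1`.

Coassociativity then compares two sums over `C ⊆ B ⊆ D` of the same terms, with factors `q_B(D)`,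
`midFactor B C` and `r_C(D)`. On one side `C` is chosen first, then a set of chords inside each face
of `C`, which together with `C` form `B`; on the other side `B` is chosen first, then `C ⊆ B`. The
grading and the counit follow from the count of degrees. The terms `C = ∅` and `C = D` of the
coproduct are `D ⊗ 1` and `1 ⊗ D`, so left and right convolution inverses of the identity are found
by recursion on the degree; they coincide and give the antipode. -/

variable {n m : ℕ} {B C K D : Finset (Sym2 (Fin (n + 1)))} {S T : Finset (Fin (n + 1))}
  {i j l a b v w : Fin (n + 1)} {c e : Sym2 (Fin (n + 1))}

/-! ## Chords separating sides -/

/-- Pairwise non-crossing sets of chords. -/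
def Noncrossing (K : Finset (Sym2 (Fin (n + 1)))) : Prop :=
  ∀ a b c d : Fin (n + 1), a < b → b < c → c < d → s(a, c) ∈ K → s(b, d) ∉ K

/-- The chord `c` separates the sides `i` and `j`. -/
def Sep (i j : Fin (n + 1)) (c : Sym2 (Fin (n + 1))) : Prop :=
  ∃ a b, c = s(a, b) ∧ a < b ∧ ¬ ((a ≤ i ∧ i < b) ↔ (a ≤ j ∧ j < b))

/-- The chord `c` separates two of the sides in `S`. -/
def Essential (S : Finset (Fin (n + 1))) (c : Sym2 (Fin (n + 1))) : Prop :=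
  ∃ i ∈ S, ∃ j ∈ S, Sep i j c

lemma Noncrossing.mono (h : Noncrossing K) (hC : C ⊆ K) : Noncrossing C :=
  fun a b c d h1 h2 h3 h4 h5 => h a b c d h1 h2 h3 (hC h4) (hC h5)

lemma Noncrossing.not_lt {d : Fin (n + 1)} (h : Noncrossing K) (h1 : s(a, v) ∈ K)
    (h2 : s(b, d) ∈ K) : ¬ (a < b ∧ b < v ∧ v < d) :=
  fun h' => h a b v d h'.1 h'.2.1 h'.2.2 h1 h2

lemma sep_mk_of_lt (h : a < b) :
    Sep i j s(a, b) ↔ ¬ ((a ≤ i ∧ i < b) ↔ (a ≤ j ∧ j < b)) := by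
  constructor
  · rintro ⟨a', b', h1, h2, h3⟩
    rw [Sym2.eq_iff] at h1
    rcases h1 with ⟨rfl, rfl⟩ | ⟨rfl, rfl⟩
    · exact h3
    · exact absurd h (not_lt.mpr h2.le)
  · exact fun h' => ⟨a, b, rfl, h, h'⟩

lemma Sep.symm (h : Sep i j c) : Sep j i c := by
  obtain ⟨a, b, h1, h2, h3⟩ := h
  exact ⟨a, b, h1, h2, fun h => h3 h.symm⟩

lemma sep_comm : Sep i j c ↔ Sep j i c := ⟨Sep.symm, Sep.symm⟩

lemma Sep.ne (h : Sep i j c) : i ≠ j := by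
  rintro rfl
  obtain ⟨a, b, h1, h2, h3⟩ := h
  exact h3 Iff.rfl

/-- The dual description of separation: exactly one end of the chord lies on the arc of vertices
`(i, j]`. It is symmetric in the two ends, and the arc never contains the root. -/
lemma sep_mk (hij : i ≤ j) :
    Sep i j s(v, w) ↔ ¬ ((i < v ∧ v ≤ j) ↔ (i < w ∧ w ≤ j)) := by
  rcases lt_trichotomy v w with h | rfl | h
  · rw [sep_mk_of_lt h]
    simp only [Fin.lt_def, Fin.le_def] at *
    omega
  · constructor
    · rintro ⟨a, b, h1, h2, -⟩
      rw [Sym2.eq_iff] at h1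
      rcases h1 with ⟨rfl, rfl⟩ | ⟨rfl, rfl⟩ <;> exact absurd h2 (lt_irrefl _)
    · exact fun h => absurd Iff.rfl h
  · rw [Sym2.eq_swap, sep_mk_of_lt h]
    simp only [Fin.lt_def, Fin.le_def] at *
    omega

lemma sameFace_iff_forall_not_sep : SameFace C i j ↔ ∀ c ∈ C, ¬ Sep i j c := by
  constructor
  · rintro h c hc ⟨a, b, rfl, hab, h'⟩
    exact h' (h a b hab hc)
  · intro h a b hab hc
    have := h _ hc
    rwa [sep_mk_of_lt hab, not_not] at this

lemma sameFace_iff (hij : i ≤ j) :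
    SameFace C i j ↔ ∀ v w, s(v, w) ∈ C → ((i < v ∧ v ≤ j) ↔ (i < w ∧ w ≤ j)) := by
  rw [sameFace_iff_forall_not_sep]
  constructor
  · intro h v w hc
    have := h _ hc
    rwa [sep_mk hij, not_not] at this
  · intro h c
    induction c with
    | _ v w =>
      intro hc
      rw [sep_mk hij, not_not]
      exact h v w hc

lemma SameFace.refl (C : Finset (Sym2 (Fin (n + 1)))) (i : Fin (n + 1)) : SameFace C i i :=
  fun _ _ _ _ => Iff.rfl

lemma SameFace.symm (h : SameFace C i j) : SameFace C j i :=
  fun a b hab hc => (h a b hab hc).symm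

lemma SameFace.trans (h : SameFace C i j) (h' : SameFace C j l) : SameFace C i l :=
  fun a b hab hc => (h a b hab hc).trans (h' a b hab hc)

lemma SameFace.mono (h : SameFace K i j) (hC : C ⊆ K) : SameFace C i j :=
  fun a b hab hc => h a b hab (hC hc)

lemma SameFace.not_sep (h : SameFace C i j) (hc : c ∈ C) : ¬ Sep i j c :=
  sameFace_iff_forall_not_sep.mp h c hc

lemma Sep.not_sep_of_sep (h : Sep i j c) (h' : Sep i l c) : ¬ Sep j l c := by
  obtain ⟨a, b, rfl, hab, h1⟩ := h
  rw [sep_mk_of_lt hab] at *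
  tauto

/-- A chord that does not cross `e` separates at most one pair of sides not separated by `e`. -/
lemma not_sep_of_noncrossing {i' j' : Fin (n + 1)} (hK : Noncrossing K) (hc : c ∈ K) (he : e ∈ K)
    (h1 : Sep i i' c) (h2 : Sep j j' c) (h3 : ¬ Sep i i' e) (h4 : ¬ Sep j j' e) :
    ¬ Sep i j e := by
  rintro ⟨p, q, rfl, hpq, h5⟩
  obtain ⟨a, b, rfl, hab, h1⟩ := h1
  rw [sep_mk_of_lt hab] at h2
  rw [sep_mk_of_lt hpq, not_not] at h3 h4
  have n1 := hK.not_lt hc he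
  have n2 := hK.not_lt he hc
  simp only [Fin.lt_def, Fin.le_def] at *
  omega

/-! ### Connectedness of the chord graph, and dissections in terms of faces -/

lemma chordGraph_adj : (chordGraph K).Adj v w ↔ s(v, w) ∈ K ∧ v ≠ w := by
  simp [chordGraph]

lemma reachable_of_mem (h : s(v, w) ∈ K) : (chordGraph K).Reachable v w := by
  by_cases hvw : v = w
  · rw [hvw]
  · exact (chordGraph_adj.mpr ⟨h, hvw⟩).reachable

lemma mem_of_reachable {V : Type*} {G : SimpleGraph V} {P : V → Prop}
    (hP : ∀ v w, G.Adj v w → P v → P w) {v w : V} (h : G.Reachable v w) (hv : P v) : P w := by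
  obtain ⟨p⟩ := h
  induction p with
  | nil => exact hv
  | cons hadj _ ih => exact ih (hP _ _ hadj hv)

/-- If no chord separates `i < j`, then no chord leaves the arc `(i, j]`, which contains `j` but not
the root. -/
lemma eq_of_sameFace_of_connected (h : (chordGraph K).Connected) (hij : SameFace K i j) :
    i = j := by
  by_contra hne
  wlog hlt : i < j generalizing i j
  · exact this hij.symm (Ne.symm hne) (lt_of_le_of_ne (not_lt.mp hlt) (Ne.symm hne))
  rw [sameFace_iff hlt.le] at hij
  have := mem_of_reachable (P := fun v => i < v ∧ v ≤ j)
    (fun v w hvw hv => (hij v w (chordGraph_adj.mp hvw).1).mp hv) (h.preconnected j 0)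
    ⟨hlt, le_rfl⟩
  exact absurd this.1 (Fin.not_lt_zero i)

/-- If some vertex is not connected to the root, take the first maximal run of consecutive such
vertices. The two sides just before and at the end of this run lie in the same face: a chord leaving
the run would have to end beyond it, and would then shield from the root the vertex following the
run, although that vertex is connected to the root. -/
lemma connected_of_forall_sameFace (hK : Noncrossing K)
    (hsep : ∀ i j, SameFace K i j → i = j) : (chordGraph K).Connected := by
  classical
  by_contra hcon
  let R : Fin (n + 1) → Prop := fun v => (chordGraph K).Reachable 0 v
  have hR : ∀ v w, s(v, w) ∈ K → R v → R w := fun v w h hv => hv.trans (reachable_of_mem h)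
  have hex : ∃ v : ℕ, ∃ h : v < n + 1, ¬ R ⟨v, h⟩ := by
    by_contra hall
    push Not at hall
    exact hcon ⟨fun v w => (hall v v.2).symm.trans (hall w w.2)⟩
  set v0 := Nat.find hex with hv0
  obtain ⟨hv0n, hRv0⟩ := Nat.find_spec hex
  have hmin : ∀ v (h : v < n + 1), v < v0 → R ⟨v, h⟩ := by
    intro v h hlt
    have := Nat.find_min hex hlt
    push Not at this
    exact this h
  have hv0pos : v0 ≠ 0 := by
    intro h0
    apply hRv0
    have : (⟨v0, hv0n⟩ : Fin (n + 1)) = 0 := Fin.ext h0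
    rw [this]
  -- The end of the run: the first vertex from `v0` on that is connected to the root. The value `n +
  -- 1`, where the condition is void, means that there is none.
  have hex2 : ∃ y : ℕ, v0 ≤ y ∧ ∀ h : y < n + 1, R ⟨y, h⟩ :=
    ⟨n + 1, by omega, fun h => absurd h (by omega)⟩
  set y := Nat.find hex2 with hy
  obtain ⟨hy1, hy2⟩ := Nat.find_spec hex2
  have hgap : ∀ v (h : v < n + 1), v0 ≤ v → v < y → ¬ R ⟨v, h⟩ := by
    intro v h h1 h2 h3
    exact Nat.find_min hex2 h2 ⟨h1, fun _ => h3⟩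
  have hyn : y ≤ n + 1 := Nat.find_min' hex2 ⟨by omega, fun h => absurd h (by omega)⟩
  have hyv : v0 < y := by
    rcases Nat.lt_or_ge v0 y with h | h
    · exact h
    · have : y = v0 := le_antisymm h hy1
      have h2 : (⟨y, by omega⟩ : Fin (n + 1)) = ⟨v0, hv0n⟩ := Fin.ext this
      exact absurd (hy2 (by omega)) (by rw [h2]; exact hRv0)
  let x : Fin (n + 1) := ⟨v0 - 1, by omega⟩
  let z : Fin (n + 1) := ⟨y - 1, by omega⟩
  have key : SameFace K x z := by
    rw [sameFace_iff_forall_not_sep]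
    have main : ∀ v w : Fin (n + 1), s(v, w) ∈ K → (x < v ∧ v ≤ z) → ¬ (x < w ∧ w ≤ z) →
        False := by
      intro v w hvw hv hw
      have hRv : ¬ R v := by
        refine hgap v v.2 ?_ ?_ <;> simp only [Fin.lt_def, Fin.le_def, x, z] at hv <;> omega
      have hRw : ¬ R w := fun h => hRv (hR w v (by rwa [Sym2.eq_swap]) h)
      have hwx : v0 ≤ w.1 := by
        by_contra h
        exact hRw (hmin w w.2 (by omega))
      have hwy : y ≤ w.1 := by
        by_contra h
        exact hw ⟨by simp only [Fin.lt_def, x]; omega, by simp only [Fin.le_def, z]; omega⟩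
      have hyn' : y < n + 1 := lt_of_le_of_lt hwy w.2
      have hRy := hy2 hyn'
      have hyw : y ≠ w.1 := by
        intro h
        apply hRw
        have : w = ⟨y, hyn'⟩ := Fin.ext h.symm
        rw [this]; exact hRy
      -- A path from the root cannot enter the open arc between `v` and `w`: it would cross the
      -- chord, or pass through `v` or `w`, which are not connected to the root. But `y` is in this
      -- arc.
      have hclosed := mem_of_reachable (G := chordGraph K)
        (P := fun u => R u ∧ ¬ (v < u ∧ u < w)) (v := 0) (w := ⟨y, hyn'⟩) ?_ hRy ?_
      · apply hclosed.2
        simp only [Fin.lt_def, Fin.le_def, x, z] at *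
        omega
      · intro u u' huu ⟨hu1, hu2⟩
        have huK := (chordGraph_adj.mp huu).1
        have huK' : s(u', u) ∈ K := by rwa [Sym2.eq_swap]
        refine ⟨hR u u' huK hu1, fun hu' => ?_⟩
        have huv : u.1 ≠ v.1 := fun h => hRv (by rwa [← Fin.ext h])
        have huw : u.1 ≠ w.1 := fun h => hRw (by rwa [← Fin.ext h])
        have n1 := hK.not_lt huK hvw
        have n2 := hK.not_lt hvw huK'
        simp only [Fin.lt_def] at *
        omega
      · refine ⟨SimpleGraph.Reachable.refl _, fun h => absurd h.1 (Fin.not_lt_zero _)⟩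
    intro c
    induction c with
    | _ v w =>
      intro hc hs
      rw [sep_mk (by simp only [Fin.le_def, x, z]; omega)] at hs
      by_cases h1 : x < v ∧ v ≤ z
      · by_cases h2 : x < w ∧ w ≤ z
        · exact hs ⟨fun _ => h2, fun _ => h1⟩
        · exact main v w hc h1 h2
      · by_cases h2 : x < w ∧ w ≤ z
        · exact main w v (by rwa [Sym2.eq_swap]) h2 h1
        · exact hs ⟨fun h => absurd h h1, fun h => absurd h h2⟩
  have := congrArg Fin.val (hsep _ _ key)
  simp only [x, z] at this
  omega

lemma chordGraph_edgeSet (hK : ∀ c ∈ K, ¬ c.IsDiag) : (chordGraph K).edgeSet = K := by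
  rw [chordGraph, SimpleGraph.edgeSet_fromEdgeSet]
  ext c
  simp only [Set.mem_sdiff, Finset.mem_coe]
  exact ⟨fun h => h.1, fun h => ⟨h, hK c h⟩⟩

lemma le_card_of_forall_sameFace (hK : Noncrossing K) (hK' : ∀ c ∈ K, ¬ c.IsDiag)
    (hsep : ∀ i j, SameFace K i j → i = j) : n ≤ K.card := by
  have := (connected_of_forall_sameFace hK hsep).card_vert_le_card_edgeSet_add_one
  rw [chordGraph_edgeSet hK'] at this
  simpa using this

/-- The forest extends to a spanning tree of the complete graph, which has `n` edges, so nothing was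
added. -/
lemma connected_of_isAcyclic_of_card (hK : ∀ c ∈ K, ¬ c.IsDiag) (hcard : K.card = n)
    (h : (chordGraph K).IsAcyclic) : (chordGraph K).Connected := by
  obtain ⟨T, hle, -, hT⟩ :=
    (SimpleGraph.connected_top (V := Fin (n + 1))).exists_isTree_le_of_le_of_isAcyclic le_top h
  have h1 := (SimpleGraph.isTree_iff_connected_and_card.mp hT).2
  have h2 : (chordGraph K).edgeSet = T.edgeSet := by
    refine Set.eq_of_subset_of_ncard_le (SimpleGraph.edgeSet_mono hle) ?_ (Set.toFinite _)
    rw [chordGraph_edgeSet hK, Set.ncard_coe_finset, hcard]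
    rw [Nat.card_coe_set_eq] at h1
    simpa using h1.le
  rw [SimpleGraph.edgeSet_injective h2]
  exact hT.connected

theorem isDissection_iff : IsDissection n K ↔
    (∀ c ∈ K, ¬ c.IsDiag) ∧ K.card = n ∧ Noncrossing K ∧ ∀ i j, SameFace K i j → i = j := by
  constructor
  · rintro ⟨h1, h2, h3, h4⟩
    exact ⟨h1, h2, h4, fun i j =>
      eq_of_sameFace_of_connected (connected_of_isAcyclic_of_card h1 h2 h3)⟩
  · rintro ⟨h1, h2, h3, h4⟩
    refine ⟨h1, h2, ?_, h3⟩
    have hc := connected_of_forall_sameFace h3 h4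
    refine (SimpleGraph.isTree_iff_connected_and_card.mpr ⟨hc, ?_⟩).isAcyclic
    rw [chordGraph_edgeSet h1]
    simp [h2]

/-! ## Contraction of sides -/

/-- The number of sides in `S` before the vertex `v`. -/
def cnt (S : Finset (Fin (n + 1))) (v : Fin (n + 1)) : ℕ := (S.filter (· < v)).card

/-- The map on vertices given by the contraction of the sides that are not in `S`, for a set `S`
of `m + 1` sides. -/
def proj (S : Finset (Fin (n + 1))) (m : ℕ) (v : Fin (n + 1)) : Fin (m + 1) :=
  Fin.ofNat (m + 1) (cnt S v)

open Classical in
/-- The images of the chords in `K` under the contraction of the sides that are not in `S`. -/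
noncomputable def res (m : ℕ) (S : Finset (Fin (n + 1))) (K : Finset (Sym2 (Fin (n + 1)))) :
    Finset (Sym2 (Fin (m + 1))) :=
  (K.filter (Essential S)).image (Sym2.map (proj S m))

lemma cnt_le_card (S : Finset (Fin (n + 1))) (v : Fin (n + 1)) : cnt S v ≤ S.card :=
  Finset.card_filter_le _ _

lemma cnt_mono (S : Finset (Fin (n + 1))) (h : v ≤ w) : cnt S v ≤ cnt S w :=
  Finset.card_le_card (Finset.monotone_filter_right S fun _ _ hx => lt_of_lt_of_le hx h)

lemma cnt_orderEmbOfFin {k : ℕ} (h : S.card = k) (i : Fin k) :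
    cnt S (S.orderEmbOfFin h i) = i := by
  have : S.filter (· < S.orderEmbOfFin h i) =
      (Finset.Iio i).map (S.orderEmbOfFin h).toEmbedding := by
    ext x
    simp only [Finset.mem_filter, Finset.mem_map, Finset.mem_Iio, RelEmbedding.coe_toEmbedding]
    constructor
    · rintro ⟨hx, hlt⟩
      have : x ∈ Set.range (S.orderEmbOfFin h) := by rw [Finset.range_orderEmbOfFin]; exact hx
      obtain ⟨y, rfl⟩ := this
      exact ⟨y, (OrderEmbedding.lt_iff_lt _).mp hlt, rfl⟩
    · rintro ⟨y, hy, rfl⟩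
      exact ⟨Finset.orderEmbOfFin_mem _ _ _, (OrderEmbedding.lt_iff_lt _).mpr hy⟩
  rw [cnt, this, Finset.card_map, Fin.card_Iio]

lemma orderEmbOfFin_lt_iff {k : ℕ} (h : S.card = k) (i : Fin k) :
    S.orderEmbOfFin h i < v ↔ i.1 < cnt S v := by
  constructor
  · intro hlt
    rw [← cnt_orderEmbOfFin h i]
    refine Finset.card_lt_card (Finset.ssubset_iff_of_subset ?_ |>.mpr
      ⟨S.orderEmbOfFin h i, ?_, ?_⟩)
    · exact Finset.monotone_filter_right S fun _ _ hx => lt_trans hx hlt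
    · simp [hlt]
    · simp
  · intro hlt
    by_contra hle
    have := cnt_mono S (not_lt.mp hle)
    rw [cnt_orderEmbOfFin] at this
    omega

lemma le_orderEmbOfFin_iff {k : ℕ} (h : S.card = k) (i : Fin k) :
    v ≤ S.orderEmbOfFin h i ↔ cnt S v ≤ i.1 := by
  rw [← not_lt, orderEmbOfFin_lt_iff, not_lt]

lemma proj_val_of_lt (h : cnt S v < m + 1) : (proj S m v).1 = cnt S v :=
  Nat.mod_eq_of_lt h

/-- The vertices after the last side in `S` wrap around to the root. -/
lemma proj_val_of_eq (h : cnt S v = m + 1) : (proj S m v).1 = 0 := by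
  simp [proj, h]

lemma proj_orderEmbOfFin (h : S.card = m + 1) (j : Fin (m + 1)) :
    proj S m (S.orderEmbOfFin h j) = j := by
  apply Fin.ext
  rw [proj_val_of_lt] <;> rw [cnt_orderEmbOfFin]
  exact j.2

/-- The arc between two sides is the preimage of the arc between their images. The vertices that
wrap around to the root cause no trouble, since they lie beyond the last side and the root is in no
such arc. -/
lemma between_iff (h : S.card = m + 1) (i j : Fin (m + 1)) :
    (S.orderEmbOfFin h i < v ∧ v ≤ S.orderEmbOfFin h j) ↔
      (i < proj S m v ∧ proj S m v ≤ j) := by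
  rw [orderEmbOfFin_lt_iff, le_orderEmbOfFin_iff, Fin.lt_def, Fin.le_def]
  rcases Nat.lt_or_ge (cnt S v) (m + 1) with h' | h'
  · rw [proj_val_of_lt h']
  · have h2 : cnt S v = m + 1 := le_antisymm (h ▸ cnt_le_card S v) h'
    rw [proj_val_of_eq h2]
    have := j.2
    omega

lemma exists_orderEmbOfFin {k : ℕ} (h : S.card = k) (hi : i ∈ S) :
    ∃ i', S.orderEmbOfFin h i' = i := by
  have : i ∈ Set.range (S.orderEmbOfFin h) := by rw [Finset.range_orderEmbOfFin]; exact hi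
  exact this

lemma sep_map_proj (h : S.card = m + 1) (i j : Fin (m + 1)) :
    Sep i j (c.map (proj S m)) ↔ Sep (S.orderEmbOfFin h i) (S.orderEmbOfFin h j) c := by
  wlog hij : i ≤ j generalizing i j
  · rw [sep_comm, this j i (le_of_not_ge hij), sep_comm]
  induction c with
  | _ v w =>
    rw [Sym2.map_mk, sep_mk hij, sep_mk ((OrderEmbedding.le_iff_le _).mpr hij), between_iff,
      between_iff]

lemma exists_sep_of_not_isDiag (hc : ¬ c.IsDiag) : ∃ i j, Sep i j c := by
  induction c with
  | _ v w =>
    wlog h : v < w generalizing v w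
    · obtain ⟨i, j, hs⟩ := this w v (by rwa [Sym2.eq_swap])
        (lt_of_le_of_ne (not_lt.mp h) fun h => hc (by simp [h]))
      exact ⟨i, j, by rwa [Sym2.eq_swap]⟩
    · refine ⟨v, w, ?_⟩
      rw [sep_mk_of_lt h]
      exact fun h' => absurd (h'.mp ⟨le_rfl, h⟩).2 (lt_irrefl w)

lemma Sep.not_isDiag (h : Sep i j c) : ¬ c.IsDiag := by
  obtain ⟨a, b, rfl, hab, -⟩ := h
  simpa using hab.ne

lemma essential_iff (h : S.card = m + 1) :
    Essential S c ↔ ¬ (c.map (proj S m)).IsDiag := by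
  constructor
  · rintro ⟨i, hi, j, hj, hs⟩
    obtain ⟨i, rfl⟩ := exists_orderEmbOfFin h hi
    obtain ⟨j, rfl⟩ := exists_orderEmbOfFin h hj
    exact ((sep_map_proj h i j).mpr hs).not_isDiag
  · intro hc
    obtain ⟨i, j, hs⟩ := exists_sep_of_not_isDiag hc
    exact ⟨_, Finset.orderEmbOfFin_mem S h i, _, Finset.orderEmbOfFin_mem S h j,
      (sep_map_proj h i j).mp hs⟩

lemma Essential.mono {T : Finset (Fin (n + 1))} (h : Essential S c) (hST : S ⊆ T) :
    Essential T c := by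
  obtain ⟨i, hi, j, hj, hs⟩ := h
  exact ⟨i, hST hi, j, hST hj, hs⟩

lemma mem_res {c' : Sym2 (Fin (m + 1))} :
    c' ∈ res m S K ↔ ∃ c ∈ K, Essential S c ∧ c.map (proj S m) = c' := by
  simp [res, and_assoc]

lemma not_isDiag_of_mem_res (h : S.card = m + 1) {c' : Sym2 (Fin (m + 1))}
    (hc : c' ∈ res m S K) : ¬ c'.IsDiag := by
  obtain ⟨c, -, hc', rfl⟩ := mem_res.mp hc
  exact (essential_iff h).mp hc'

lemma sameFace_res (h : S.card = m + 1) (i j : Fin (m + 1)) :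
    SameFace (res m S K) i j ↔ SameFace K (S.orderEmbOfFin h i) (S.orderEmbOfFin h j) := by
  rw [sameFace_iff_forall_not_sep, sameFace_iff_forall_not_sep]
  constructor
  · intro h' c hc hs
    exact h' _ (mem_res.mpr ⟨c, hc, ⟨_, Finset.orderEmbOfFin_mem S h i, _,
      Finset.orderEmbOfFin_mem S h j, hs⟩, rfl⟩) ((sep_map_proj h i j).mpr hs)
  · intro h' c hc hs
    obtain ⟨c, hcK, -, rfl⟩ := mem_res.mp hc
    exact h' c hcK ((sep_map_proj h i j).mp hs)

lemma lt_of_proj_lt (h : S.card = m + 1) (hvw : proj S m v < proj S m w) :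
    v < w ∨ (proj S m v = 0 ∧ cnt S v = m + 1) := by
  rcases Nat.lt_or_ge (cnt S v) (m + 1) with h' | h'
  · left
    by_contra hle
    have h1 := cnt_mono S (not_lt.mp hle)
    rw [Fin.lt_def, proj_val_of_lt h', proj_val_of_lt (by omega)] at hvw
    omega
  · right
    have h2 : cnt S v = m + 1 := le_antisymm (h ▸ cnt_le_card S v) h'
    exact ⟨Fin.ext (proj_val_of_eq h2), h2⟩

/-- Vertices with non-zero images are ordered like their images, so a crossing of images lifts to a
crossing. Only a preimage of the root may be out of order. -/
lemma noncrossing_res (h : S.card = m + 1) (hK : Noncrossing K) : Noncrossing (res m S K) := by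
  intro a b c d hab hbc hcd hac hbd
  obtain ⟨e, heK, -, he⟩ := mem_res.mp hac
  obtain ⟨f, hfK, -, hf⟩ := mem_res.mp hbd
  have key : ∀ x y : Fin (n + 1), 0 < proj S m x → proj S m x < proj S m y → x < y := by
    intro x y hx hxy
    rcases lt_of_proj_lt h hxy with h' | h'
    · exact h'
    · exact absurd h'.1 hx.ne'
  have hb0 : 0 < b := lt_of_le_of_lt (Fin.zero_le a) hab
  have ex : ∀ (e : Sym2 (Fin (n + 1))) (a c : Fin (m + 1)), e.map (proj S m) = s(a, c) →
      ∃ x y, e = s(x, y) ∧ proj S m x = a ∧ proj S m y = c := by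
    intro e a c he
    induction e with
    | _ x y =>
      rw [Sym2.map_mk, Sym2.eq_iff] at he
      rcases he with ⟨h1, h2⟩ | ⟨h1, h2⟩
      · exact ⟨x, y, rfl, h1, h2⟩
      · exact ⟨y, x, Sym2.eq_swap, h2, h1⟩
  obtain ⟨x, z, rfl, rfl, rfl⟩ := ex e a c he
  obtain ⟨y, t, rfl, rfl, rfl⟩ := ex f b d hf
  have hyz := key y z hb0 hbc
  have hzt := key z t (hb0.trans hbc) hcd
  rcases lt_of_proj_lt h hab with h' | ⟨-, h'⟩
  · exact hK.not_lt heK hfK ⟨h', hyz, hzt⟩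
  -- Here `x` lies beyond the last side in `S`, so the crossing appears in the rotated order `y < z
  -- < t < x`.
  · refine hK.not_lt hfK (show s(z, x) ∈ K by rwa [Sym2.eq_swap]) ⟨hyz, hzt, ?_⟩
    by_contra hle
    have h1 := cnt_mono S (not_lt.mp hle)
    have h2 := cnt_le_card S t
    rw [h] at h2
    have := proj_val_of_eq (m := m) (S := S) (v := t) (by omega)
    rw [Fin.lt_def, this] at hcd
    omega

/-- Contracting in two steps. -/
lemma proj_proj (h : S.card = m + 1) (T : Finset (Fin (m + 1))) {k : ℕ} (hT : T.card = k + 1)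
    (v : Fin (n + 1)) :
    proj T k (proj S m v) = proj (T.map (S.orderEmbOfFin h).toEmbedding) k v := by
  have hcard : (T.map (S.orderEmbOfFin h).toEmbedding).card = k + 1 := by
    rw [Finset.card_map, hT]
  have hcnt : cnt (T.map (S.orderEmbOfFin h).toEmbedding) v =
      (T.filter (fun t => t.1 < cnt S v)).card := by
    rw [cnt, Finset.filter_map, Finset.card_map]
    congr 1
    ext t
    simp [orderEmbOfFin_lt_iff]
  rcases Nat.lt_or_ge (cnt S v) (m + 1) with h' | h'
  · unfold proj
    congr 1
    rw [hcnt, cnt]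
    congr 1
    ext t
    rw [Finset.mem_filter, Finset.mem_filter, Fin.lt_def, ← proj, proj_val_of_lt h']
  · have h2 : cnt S v = m + 1 := le_antisymm (h ▸ cnt_le_card S v) h'
    have h3 : proj S m v = 0 := Fin.ext (proj_val_of_eq h2)
    have h4 : cnt T 0 = 0 := by simp [cnt]
    have h5 : cnt (T.map (S.orderEmbOfFin h).toEmbedding) v = k + 1 := by
      rw [hcnt, h2, Finset.filter_true_of_mem (fun t _ => t.2), hT]
    apply Fin.ext
    rw [h3, proj_val_of_eq h5, proj_val_of_lt (by omega), h4]

lemma res_res (h : S.card = m + 1) (T : Finset (Fin (m + 1))) {k : ℕ} (hT : T.card = k + 1) :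
    res k T (res m S K) = res k (T.map (S.orderEmbOfFin h).toEmbedding) K := by
  have hT' : (T.map (S.orderEmbOfFin h).toEmbedding).card = k + 1 := by
    rw [Finset.card_map, hT]
  have hmap : ∀ c : Sym2 (Fin (n + 1)), (c.map (proj S m)).map (proj T k) =
      c.map (proj (T.map (S.orderEmbOfFin h).toEmbedding) k) := by
    intro c
    rw [Sym2.map_map]
    congr 1
    funext v
    exact proj_proj h T hT v
  ext c'
  rw [mem_res, mem_res]
  constructor
  · rintro ⟨d, hd, hd2, rfl⟩
    obtain ⟨c, hc, hc2, rfl⟩ := mem_res.mp hd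
    refine ⟨c, hc, ?_, (hmap c).symm⟩
    rw [essential_iff hT']
    rw [essential_iff hT, hmap] at hd2
    exact hd2
  · rintro ⟨c, hc, hc2, rfl⟩
    refine ⟨c.map (proj S m), mem_res.mpr ⟨c, hc, ?_, rfl⟩, ?_, hmap c⟩
    · refine hc2.mono ?_
      intro x hx
      obtain ⟨y, -, rfl⟩ := Finset.mem_map.mp hx
      exact Finset.orderEmbOfFin_mem S h y
    · rw [essential_iff hT, hmap]
      exact (essential_iff hT').mp hc2

lemma proj_univ (v : Fin (n + 1)) : proj Finset.univ n v = v := by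
  have : cnt (Finset.univ : Finset (Fin (n + 1))) v = v.1 := by
    have : Finset.univ.filter (· < v) = Finset.Iio v := by ext; simp
    rw [cnt, this, Fin.card_Iio]
  apply Fin.ext
  rw [proj_val_of_lt (by rw [this]; exact v.2), this]

lemma res_univ (hK : ∀ c ∈ K, ¬ c.IsDiag) : res n Finset.univ K = K := by
  have h1 : (proj Finset.univ n : Fin (n + 1) → Fin (n + 1)) = id := funext proj_univ
  ext c
  rw [mem_res, h1]
  constructor
  · rintro ⟨d, hd, -, rfl⟩
    rwa [Sym2.map_id, id]
  · intro hc
    refine ⟨c, hc, ?_, by rw [Sym2.map_id, id]⟩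
    rw [essential_iff (m := n) (by simp), h1, Sym2.map_id, id]
    exact hK c hc

/-! ## Counting chords and sides -/

open Classical in
/-- The sides in `S` are separated by `K`, with as few essential chords as possible. -/
structure Good (S : Finset (Fin (n + 1))) (K : Finset (Sym2 (Fin (n + 1)))) : Prop where
  noncrossing : Noncrossing K
  sep : ∀ i ∈ S, ∀ j ∈ S, SameFace K i j → i = j
  card : (K.filter (Essential S)).card + 1 = S.card

open Classical in
-- The contraction to `S` still separates all its sides, so its chord graph is connected and has at
-- least `|S| - 1` edges; these are images of essential chords.
lemma card_le_of_forall_sameFace (hK : Noncrossing K)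
    (hsep : ∀ i ∈ S, ∀ j ∈ S, SameFace K i j → i = j) :
    S.card ≤ (K.filter (Essential S)).card + 1 := by
  rcases Nat.eq_zero_or_eq_succ_pred S.card with h | h
  · omega
  · have := le_card_of_forall_sameFace (noncrossing_res h hK)
      (fun c hc => not_isDiag_of_mem_res h hc) (fun i j hij =>
        (S.orderEmbOfFin h).injective (hsep _ (Finset.orderEmbOfFin_mem S h i) _
          (Finset.orderEmbOfFin_mem S h j) ((sameFace_res h i j).mp hij)))
    have h2 : (res S.card.pred S K).card ≤ (K.filter (Essential S)).card := Finset.card_image_le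
    omega

open Classical in
-- The images already number at least `|S| - 1`, which is the number of essential chords: no two of
-- these are identified.
lemma Good.card_res (hg : Good S K) (h : S.card = m + 1) :
    (res m S K).card = (K.filter (Essential S)).card := by
  refine le_antisymm Finset.card_image_le ?_
  have := le_card_of_forall_sameFace (noncrossing_res h hg.noncrossing)
    (fun c hc => not_isDiag_of_mem_res h hc) (fun i j hij =>
      (S.orderEmbOfFin h).injective (hg.sep _ (Finset.orderEmbOfFin_mem S h i) _
        (Finset.orderEmbOfFin_mem S h j) ((sameFace_res h i j).mp hij)))
  have := hg.card
  omega

lemma Good.isDissection_res (hg : Good S K) (h : S.card = m + 1) :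
    IsDissection m (res m S K) := by
  classical
  refine isDissection_iff.mpr ⟨fun c hc => not_isDiag_of_mem_res h hc, ?_,
    noncrossing_res h hg.noncrossing, fun i j hij =>
      (S.orderEmbOfFin h).injective (hg.sep _ (Finset.orderEmbOfFin_mem S h i) _
        (Finset.orderEmbOfFin_mem S h j) ((sameFace_res h i j).mp hij))⟩
  rw [hg.card_res h]
  have := hg.card
  omega

open Classical in
lemma Good.injOn (hg : Good S K) (h : S.card = m + 1) :
    Set.InjOn (Sym2.map (proj S m)) (K.filter (Essential S) : Finset (Sym2 (Fin (n + 1)))) :=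
  Finset.card_image_iff.mp (hg.card_res h)

lemma IsDissection.isNoncrossing (hD : IsDissection n D) : Noncrossing D :=
  hD.noncrossing

lemma IsDissection.eq_of_sameFace (hD : IsDissection n D) (h : SameFace D i j) : i = j :=
  (isDissection_iff.mp hD).2.2.2 i j h

/-! ## Faces -/

lemma mem_face : j ∈ face C i ↔ SameFace C i j := by simp [face]

lemma self_mem_face : i ∈ face C i := mem_face.mpr (SameFace.refl C i)

lemma face_eq_of_sameFace (h : SameFace C i j) : face C i = face C j := by
  ext k
  rw [mem_face, mem_face]
  exact ⟨fun h' => h.symm.trans h', fun h' => h.trans h'⟩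

open Classical in
/-- The sides in `S` that are minimal in `S` among those of the same face. -/
noncomputable def minOn (S : Finset (Fin (n + 1))) (C : Finset (Sym2 (Fin (n + 1)))) :
    Finset (Fin (n + 1)) :=
  S.filter fun i => ∀ j ∈ S, SameFace C i j → i ≤ j

lemma mem_minOn : i ∈ minOn S C ↔ i ∈ S ∧ ∀ j ∈ S, SameFace C i j → i ≤ j := by
  simp [minOn]

lemma mem_minSides : i ∈ minSides C ↔ ∀ j, SameFace C i j → i ≤ j := by
  simp [minSides]

lemma minOn_univ : minOn Finset.univ C = minSides C := by
  ext i
  simp [mem_minOn, mem_minSides]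

lemma exists_mem_minOn (hi : i ∈ S) : ∃ k ∈ minOn S C, SameFace C k i ∧ k ≤ i := by
  classical
  have hne : (S.filter fun j => SameFace C i j).Nonempty :=
    ⟨i, Finset.mem_filter.mpr ⟨hi, SameFace.refl C i⟩⟩
  have hmem := Finset.mem_filter.mp (Finset.min'_mem _ hne)
  refine ⟨_, mem_minOn.mpr ⟨hmem.1, fun j hj hs => ?_⟩, hmem.2.symm, ?_⟩
  · exact Finset.min'_le _ _ (Finset.mem_filter.mpr ⟨hj, hmem.2.trans hs⟩)
  · exact Finset.min'_le _ _ (Finset.mem_filter.mpr ⟨hi, SameFace.refl C i⟩)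

lemma exists_mem_minSides (C : Finset (Sym2 (Fin (n + 1)))) (i : Fin (n + 1)) :
    ∃ k ∈ minSides C, SameFace C k i ∧ k ≤ i := by
  rw [← minOn_univ]
  exact exists_mem_minOn (Finset.mem_univ i)

lemma eq_of_mem_minOn (hi : i ∈ minOn S C) (hj : j ∈ minOn S C) (h : SameFace C i j) : i = j :=
  le_antisymm ((mem_minOn.mp hi).2 j (mem_minOn.mp hj).1 h)
    ((mem_minOn.mp hj).2 i (mem_minOn.mp hi).1 h.symm)

lemma eq_of_mem_minSides (hi : i ∈ minSides C) (hj : j ∈ minSides C) (h : SameFace C i j) :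
    i = j := by
  rw [← minOn_univ] at hi hj
  exact eq_of_mem_minOn hi hj h

lemma zero_mem_minSides : (0 : Fin (n + 1)) ∈ minSides C :=
  mem_minSides.mpr fun j _ => Fin.zero_le j

lemma not_mem_of_essential_face (hc : Essential (face C i) c) : c ∉ C := by
  obtain ⟨j, hj, k, hk, hs⟩ := hc
  exact fun h => ((mem_face.mp hj).symm.trans (mem_face.mp hk)).not_sep h hs

/-- A chord is essential for at most one face. -/
lemma sameFace_of_essential (hK : Noncrossing K) (hC : C ⊆ K) (hc : c ∈ K)
    (h1 : Essential (face C i) c) (h2 : Essential (face C j) c) : SameFace C i j := by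
  obtain ⟨i1, hi1, i2, hi2, hs⟩ := h1
  obtain ⟨j1, hj1, j2, hj2, hs'⟩ := h2
  rw [mem_face] at *
  have : SameFace C i1 j1 := by
    rw [sameFace_iff_forall_not_sep]
    intro e he
    exact not_sep_of_noncrossing hK hc (hC he) hs hs' ((hi1.symm.trans hi2).not_sep he)
      ((hj1.symm.trans hj2).not_sep he)
  exact hi1.trans (this.trans hj1.symm)

section Counting

open Classical

lemma sum_card_face : ∑ i ∈ minSides C, (face C i).card = n + 1 := by
  have h : Finset.univ = (minSides C).biUnion (face C) := by
    ext i
    simp only [Finset.mem_univ, Finset.mem_biUnion, true_iff]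
    obtain ⟨k, hk, hs, -⟩ := exists_mem_minSides C i
    exact ⟨k, hk, mem_face.mpr hs⟩
  have h2 := congrArg Finset.card h
  rw [Finset.card_biUnion, Finset.card_univ, Fintype.card_fin] at h2
  · exact h2.symm
  · intro i hi j hj hij
    refine Finset.disjoint_left.mpr fun k hk hk' => ?_
    exact hij (eq_of_mem_minSides hi hj ((mem_face.mp hk).trans (mem_face.mp hk').symm))

lemma disjoint_essential (hK : Noncrossing K) (hC : C ⊆ K) :
    Set.PairwiseDisjoint (minSides C : Set (Fin (n + 1)))
      (fun i => K.filter (Essential (face C i))) := by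
  intro i hi j hj hij
  refine Finset.disjoint_left.mpr fun c hc hc' => hij ?_
  rw [Finset.mem_filter] at hc hc'
  exact eq_of_mem_minSides hi hj (sameFace_of_essential hK hC hc.1 hc.2 hc'.2)

lemma biUnion_essential_subset :
    ((minSides C).biUnion fun i => K.filter (Essential (face C i))) ⊆ K \ C := by
  intro c hc
  obtain ⟨i, -, hc⟩ := Finset.mem_biUnion.mp hc
  rw [Finset.mem_filter] at hc
  exact Finset.mem_sdiff.mpr ⟨hc.1, not_mem_of_essential_face hc.2⟩

lemma card_minSides_le (hC : Noncrossing C) :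
    (minSides C).card ≤ (C.filter (Essential (minSides C))).card + 1 :=
  card_le_of_forall_sameFace hC fun _ hi _ hj => eq_of_mem_minSides hi hj

lemma card_face_le (hD : IsDissection n D) (i : Fin (n + 1)) :
    (face C i).card ≤ (D.filter (Essential (face C i))).card + 1 :=
  card_le_of_forall_sameFace hD.noncrossing fun _ _ _ _ h => hD.eq_of_sameFace h

/-- Double counting. Summed over the faces, the lower bounds give `n + 1 ≤ |D \ C| + |minSides C|`,
because the essential chords of distinct faces are disjoint and avoid `C`. Also `|minSides C| ≤ |C|
+ 1` and `|D \ C| + |C| = n`, so no inequality used can be strict. -/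
lemma counting (hD : IsDissection n D) (hC : C ⊆ D) :
    (minSides C).card = C.card + 1 ∧
    (C.filter (Essential (minSides C))).card = C.card ∧
    (∀ i ∈ minSides C, (face C i).card = (D.filter (Essential (face C i))).card + 1) ∧
    ((minSides C).biUnion fun i => D.filter (Essential (face C i))).card = (D \ C).card := by
  have h1 := card_minSides_le (hD.isNoncrossing.mono hC)
  have h2 : (C.filter (Essential (minSides C))).card ≤ C.card := Finset.card_filter_le _ _
  have h3 := Finset.card_le_card (biUnion_essential_subset (K := D) (C := C))
  have h4 := Finset.card_sdiff_add_card_eq_card hC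
  rw [hD.card_eq] at h4
  rw [Finset.card_biUnion (disjoint_essential hD.noncrossing hC)] at h3 ⊢
  have h5 : ∑ i ∈ minSides C, (face C i).card ≤
      ∑ i ∈ minSides C, ((D.filter (Essential (face C i))).card + 1) :=
    Finset.sum_le_sum fun i _ => card_face_le hD i
  have h6 := h5
  rw [Finset.sum_add_distrib, sum_card_face, Finset.sum_const, smul_eq_mul, mul_one] at h6
  refine ⟨by omega, by omega, ?_, by omega⟩
  refine (Finset.sum_eq_sum_iff_of_le fun i _ => card_face_le hD i).mp (le_antisymm h5 ?_)
  rw [Finset.sum_add_distrib, sum_card_face, Finset.sum_const, smul_eq_mul, mul_one]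
  omega

lemma card_minSides (hD : IsDissection n D) (hC : C ⊆ D) : (minSides C).card = C.card + 1 :=
  (counting hD hC).1

lemma essential_minSides (hD : IsDissection n D) (hC : C ⊆ D) (hc : c ∈ C) :
    Essential (minSides C) c :=
  Finset.filter_card_eq (counting hD hC).2.1 c hc

lemma good_minSides (hD : IsDissection n D) (hC : C ⊆ D) : Good (minSides C) C where
  noncrossing := hD.isNoncrossing.mono hC
  sep _ hi _ hj := eq_of_mem_minSides hi hj
  card := by rw [(counting hD hC).2.1, card_minSides hD hC]

lemma good_face (hD : IsDissection n D) (hC : C ⊆ D) (i : Fin (n + 1)) :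
    Good (face C i) D where
  noncrossing := hD.noncrossing
  sep _ _ _ _ h := hD.eq_of_sameFace h
  card := by
    obtain ⟨k, hk, hs, -⟩ := exists_mem_minSides C i
    rw [← face_eq_of_sameFace hs]
    exact ((counting hD hC).2.2.1 k hk).symm

lemma biUnion_essential (hD : IsDissection n D) (hC : C ⊆ D) :
    ((minSides C).biUnion fun i => D.filter (Essential (face C i))) = D \ C :=
  Finset.eq_of_subset_of_card_le biUnion_essential_subset (counting hD hC).2.2.2.ge

lemma exists_essential_face (hD : IsDissection n D) (hC : C ⊆ D) (hc : c ∈ D) (hc' : c ∉ C) :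
    ∃ i ∈ minSides C, Essential (face C i) c := by
  have := Finset.mem_sdiff.mpr ⟨hc, hc'⟩
  rw [← biUnion_essential hD hC, Finset.mem_biUnion] at this
  obtain ⟨i, hi, h⟩ := this
  exact ⟨i, hi, (Finset.mem_filter.mp h).2⟩

end Counting

/-! ## The operations `q` and `r` are contractions of sides -/

lemma cnt_add_one (hv : v.1 + 1 < n + 1) :
    cnt S (v + 1) = cnt S v + (if v ∈ S then 1 else 0) := by
  have hv' : (v + 1).1 = v.1 + 1 := Fin.val_add_one_of_lt' hv
  have : S.filter (· < v + 1) = S.filter (· < v) ∪ S.filter (· = v) := by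
    ext x
    simp only [Finset.mem_filter, Finset.mem_union, Fin.lt_def, hv', Fin.ext_iff]
    constructor
    · rintro ⟨h1, h2⟩
      rcases Nat.lt_succ_iff_lt_or_eq.mp h2 with h | h
      · exact Or.inl ⟨h1, h⟩
      · exact Or.inr ⟨h1, h⟩
    · rintro (⟨h1, h2⟩ | ⟨h1, h2⟩)
      · exact ⟨h1, by omega⟩
      · exact ⟨h1, by omega⟩
  rw [cnt, this, Finset.card_union_of_disjoint, cnt]
  · congr 1
    split_ifs with h
    · rw [Finset.filter_eq' S v, if_pos h, Finset.card_singleton]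
    · rw [Finset.filter_eq' S v, if_neg h, Finset.card_empty]
  · refine Finset.disjoint_left.mpr fun x hx hx' => ?_
    rw [Finset.mem_filter] at hx hx'
    exact hx.2.ne hx'.2

lemma proj_add_one (h : S.card = m + 1) (hv : v ∉ S) : proj S m (v + 1) = proj S m v := by
  by_cases hn : v.1 + 1 < n + 1
  · rw [proj, proj, cnt_add_one hn, if_neg hv, add_zero]
  · have hvn : v = Fin.last n := Fin.ext (by simp; omega)
    have h0 : v + 1 = 0 := by rw [hvn]; simp
    have h1 : cnt S v = m + 1 := by
      rw [cnt, Finset.filter_true_of_mem, h]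
      intro x hx
      refine lt_of_le_of_ne (hvn ▸ Fin.le_last x) ?_
      rintro rfl
      exact hv hx
    apply Fin.ext
    rw [h0, proj_val_of_eq h1, proj_val_of_lt] <;> simp [cnt]

lemma orderEmbOfFin_proj (h : S.card = m + 1) (hv : v ∈ S) :
    S.orderEmbOfFin h (proj S m v) = v := by
  obtain ⟨j, rfl⟩ := exists_orderEmbOfFin h hv
  rw [proj_orderEmbOfFin]

/-- The projection is constant along contracted sides; conversely, walking forward from `v` along
contracted sides leads to the start of the next minimal side. -/
lemma plusGraph_reachable_iff (h : (minSides C).card = m + 1) (j : Fin (m + 1)) :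
    (plusGraph C).Reachable ((minSides C).orderEmbOfFin h j) v ↔ proj (minSides C) m v = j := by
  constructor
  · intro hr
    refine mem_of_reachable (P := fun v => proj (minSides C) m v = j) ?_ hr
      (proj_orderEmbOfFin h j)
    intro x y hxy hx
    simp only [plusGraph, SimpleGraph.fromEdgeSet_adj, Set.mem_ofPred_eq] at hxy
    obtain ⟨⟨i, hi, he⟩, -⟩ := hxy
    have hi' : i ∉ minSides C := by simpa [plusSides] using hi
    have := proj_add_one h hi'
    rw [Sym2.eq_iff] at he
    rcases he with ⟨rfl, rfl⟩ | ⟨rfl, rfl⟩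
    · rw [this, hx]
    · rw [← this, hx]
  · rintro rfl
    obtain ⟨d, hd⟩ : ∃ d, n - v.1 = d := ⟨_, rfl⟩
    induction d using Nat.strong_induction_on generalizing v with
    | _ d ih =>
      by_cases hv : v ∈ minSides C
      · rw [orderEmbOfFin_proj h hv]
      · rw [← proj_add_one h hv]
        have hr : (plusGraph C).Reachable (v + 1) v := by
          by_cases hne : v + 1 = v
          · rw [hne]
          · refine SimpleGraph.Adj.reachable ?_
            simp only [plusGraph, SimpleGraph.fromEdgeSet_adj, Set.mem_ofPred_eq]
            exact ⟨⟨v, by simpa [plusSides] using hv, Sym2.eq_swap⟩, hne⟩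
        refine SimpleGraph.Reachable.trans ?_ hr
        by_cases hn : v.1 + 1 < n + 1
        · have hv' : (v + 1).1 = v.1 + 1 := Fin.val_add_one_of_lt' hn
          exact ih (n - (v + 1).1) (by omega) rfl
        -- Past the last side the walk returns to the root, where it stops because the side `0` is
        -- always minimal.
        · have hvn : v = Fin.last n := Fin.ext (by simp; omega)
          have h0 : v + 1 = 0 := by rw [hvn]; simp
          rw [h0, orderEmbOfFin_proj h zero_mem_minSides]

lemma mem_contract {T : SimpleGraph (Fin (n + 1))} {u : Fin (m + 1) → Fin (n + 1)}
    {c : Sym2 (Fin (m + 1))} : c ∈ contract T u K ↔ ∃ (j k : Fin (m + 1)) (v w : Fin (n + 1)),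
      c = s(j, k) ∧ s(v, w) ∈ K ∧ T.Reachable (u j) v ∧ T.Reachable (u k) w := by
  simp [contract]

lemma rChords_eq (hC : ∀ c ∈ C, Essential (minSides C) c) :
    rChords C = res (restDegree C) (minSides C) C := by
  have h := minSides_card C
  ext c
  rw [rChords, mem_contract, mem_res]
  constructor
  · rintro ⟨j, k, v, w, rfl, hc, hj, hk⟩
    refine ⟨s(v, w), hc, hC _ hc, ?_⟩
    exact congrArg₂ (fun x y => s(x, y)) ((plusGraph_reachable_iff h j).mp hj)
      ((plusGraph_reachable_iff h k).mp hk)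
  · rintro ⟨d, hd, -, rfl⟩
    induction d with
    | _ v w =>
      exact ⟨_, _, v, w, rfl, hd, (plusGraph_reachable_iff h _).mpr rfl,
        (plusGraph_reachable_iff h _).mpr rfl⟩

/-! ### Boundary vertices of a face and the contraction of chords -/

/-- The vertex `v` is on the boundary of the face containing the side `i`. -/
def OnBoundary (C : Finset (Sym2 (Fin (n + 1)))) (i v : Fin (n + 1)) : Prop :=
  ∀ a b : Fin (n + 1), a < b → s(a, b) ∈ C →
    ((a ≤ i ∧ i < b) → a ≤ v ∧ v ≤ b) ∧ (¬ (a ≤ i ∧ i < b) → v ≤ a ∨ b ≤ v)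

lemma proj_eq_of_not_essential (h : S.card = m + 1) (hc : ¬ Essential S s(v, w)) :
    proj S m v = proj S m w := by
  rw [essential_iff h, not_not, Sym2.map_mk] at hc
  exact hc

lemma proj_face_eq (h : (face C i).card = m + 1) (hc : s(v, w) ∈ C) :
    proj (face C i) m v = proj (face C i) m w :=
  proj_eq_of_not_essential h fun he => not_mem_of_essential_face he hc

/-- The number of steps from the vertex `v` to the vertex `u` along the polygon. -/
def stepsTo (u v : Fin (n + 1)) : ℕ := if v ≤ u then u.1 - v.1 else u.1 + (n + 1) - v.1

/-- One step of a walk along the boundary of the face, from `v` forward to the start `u` of a side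
of the face. Since the side `v` is not in the face, some chord of `C` at `v` separates it from the
face. The hypothesis `huv` says that `u` precedes `v` only if the walk wraps around after the last
side of the face. -/
lemma exists_step (hC : Noncrossing C) (hv : OnBoundary C i v) {u : Fin (n + 1)}
    (hu : SameFace C i u) (hface : v ∉ face C i)
    (huv : u < v → ∀ k, SameFace C i k → k < v) :
    ∃ w, s(v, w) ∈ C ∧ OnBoundary C i w ∧ stepsTo u w < stepsTo u v := by
  classical
  let P : Fin (n + 1) → Prop := fun w => s(v, w) ∈ C ∧ Sep v i s(v, w)
  have hne : (Finset.univ.filter P).Nonempty := by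
    have : ¬ SameFace C v i := fun h => hface (mem_face.mpr h.symm)
    rw [sameFace_iff_forall_not_sep] at this
    push Not at this
    obtain ⟨c, hc, a, b, rfl, hab, hs⟩ := this
    have hb := hv a b hab hc
    have : v = a ∨ v = b := by
      simp only [Fin.lt_def, Fin.le_def, Fin.ext_iff] at *
      omega
    rcases this with rfl | rfl
    · exact ⟨b, Finset.mem_filter.mpr ⟨Finset.mem_univ _, hc, v, b, rfl, hab, hs⟩⟩
    · exact ⟨a, Finset.mem_filter.mpr ⟨Finset.mem_univ _, by rwa [Sym2.eq_swap], a, v,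
        Sym2.eq_swap, hab, hs⟩⟩
  -- The chord hugging the face is the one whose other end is nearest to `u`. A chord of `C` cutting
  -- `w` off the face would cross it, or would start at `v` and end nearer to `u`.
  obtain ⟨w, hw, hmin⟩ := Finset.exists_min_image _ (stepsTo u) hne
  obtain ⟨-, hwC, hws⟩ := Finset.mem_filter.mp hw
  have hvw : v ≠ w := by simpa using hws.not_isDiag
  have hui : u < v → i < v := fun h => huv h i (SameFace.refl C i)
  refine ⟨w, hwC, ?_, ?_⟩
  · intro p q hpq hc
    have hvb := hv p q hpq hc
    have hup := hu p q hpq hc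
    have hm1 : v = p → ¬ (v ≤ i ∧ i < q) → stepsTo u w ≤ stepsTo u q := by
      rintro rfl hs
      exact hmin q (Finset.mem_filter.mpr ⟨Finset.mem_univ _, hc, v, q, rfl, hpq,
        fun h => hs (h.mp ⟨le_rfl, hpq⟩)⟩)
    have hm2 : v = q → (p ≤ i ∧ i < v) → stepsTo u w ≤ stepsTo u p := by
      rintro rfl hs
      exact hmin p (Finset.mem_filter.mpr ⟨Finset.mem_univ _, by rwa [Sym2.eq_swap], p, v,
        Sym2.eq_swap, hpq, fun h => lt_irrefl v (h.mpr hs).2⟩)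
    rcases lt_or_gt_of_ne hvw with hlt | hlt
    · rw [sep_mk_of_lt hlt] at hws
      have hiw : ¬ (v ≤ i ∧ i < w) := fun h => hws ⟨fun _ => h, fun _ => ⟨le_rfl, hlt⟩⟩
      have huw : ¬ (v ≤ u ∧ u < w) := fun h => hiw ((hu v w hlt hwC).mpr h)
      constructor
      · intro hin
        have h1 := hvb.1 hin
        have h2 := hup.mp hin
        refine ⟨h1.1.trans hlt.le, ?_⟩
        by_contra hqw
        have hcr := hC.not_lt hc hwC
        have hvq : v = q := by
          clear hm1 hm2
          simp only [Fin.lt_def, Fin.le_def, Fin.ext_iff] at *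
          omega
        have hm := hm2 hvq (hvq ▸ hin)
        clear hm1 hm2 hcr hvb hup
        unfold stepsTo at hm
        simp only [Fin.lt_def, Fin.le_def, Fin.ext_iff] at *
        split_ifs at hm <;> omega
      · intro hin
        have h1 := hvb.2 hin
        have h2 : ¬ (p ≤ u ∧ u < q) := fun h => hin (hup.mpr h)
        by_contra hwpq
        have hcr := hC.not_lt hwC hc
        have hvp : v = p := by
          clear hm1 hm2
          simp only [Fin.lt_def, Fin.le_def, Fin.ext_iff] at *
          omega
        have hm := hm1 hvp (hvp ▸ hin)
        clear hm1 hm2 hcr hvb hup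
        unfold stepsTo at hm
        simp only [Fin.lt_def, Fin.le_def, Fin.ext_iff] at *
        split_ifs at hm <;> omega
    · have hwC' : s(w, v) ∈ C := by rwa [Sym2.eq_swap]
      rw [Sym2.eq_swap, sep_mk_of_lt hlt] at hws
      have hiw : w ≤ i ∧ i < v := by
        by_contra h
        exact hws ⟨fun h => absurd h.2 (lt_irrefl v), fun h' => absurd h' h⟩
      have huw : w ≤ u ∧ u < v := (hu w v hlt hwC').mp hiw
      constructor
      · intro hin
        have h1 := hvb.1 hin
        have h2 := hup.mp hin
        refine ⟨?_, hlt.le.trans h1.2⟩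
        by_contra hqw
        have hcr := hC.not_lt hwC' hc
        have hvq : v = q := by
          clear hm1 hm2
          simp only [Fin.lt_def, Fin.le_def, Fin.ext_iff] at *
          omega
        have hm := hm2 hvq (hvq ▸ hin)
        clear hm1 hm2 hcr hvb hup
        unfold stepsTo at hm
        simp only [Fin.lt_def, Fin.le_def, Fin.ext_iff] at *
        split_ifs at hm <;> omega
      · intro hin
        have h1 := hvb.2 hin
        by_contra hwpq
        have hcr := hC.not_lt hc hwC'
        clear hm1 hm2
        simp only [Fin.lt_def, Fin.le_def] at *
        omega
  · unfold stepsTo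
    rcases lt_or_gt_of_ne hvw with hlt | hlt
    · rw [sep_mk_of_lt hlt] at hws
      have hiw : ¬ (v ≤ i ∧ i < w) := fun h => hws ⟨fun _ => h, fun _ => ⟨le_rfl, hlt⟩⟩
      have huw : ¬ (v ≤ u ∧ u < w) := fun h => hiw ((hu v w hlt hwC).mpr h)
      simp only [Fin.lt_def, Fin.le_def] at *
      split_ifs <;> omega
    · have hwC' : s(w, v) ∈ C := by rwa [Sym2.eq_swap]
      rw [Sym2.eq_swap, sep_mk_of_lt hlt] at hws
      have hiw : w ≤ i ∧ i < v := by
        by_contra h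
        exact hws ⟨fun h => absurd h.2 (lt_irrefl v), fun h' => absurd h' h⟩
      have huw : w ≤ u ∧ u < v := (hu w v hlt hwC').mp hiw
      simp only [Fin.lt_def, Fin.le_def] at *
      split_ifs <;> omega

/-- Contracting the chords of `C` and contracting the sides outside the face identify the same
boundary vertices: each of them is joined by chords of `C` to the start of the next side of the
face. -/
lemma chordGraph_reachable_of_onBoundary (hC : Noncrossing C) (h : (face C i).card = m + 1)
    (hv : OnBoundary C i v) :
    (chordGraph C).Reachable ((face C i).orderEmbOfFin h (proj (face C i) m v)) v := by
  obtain ⟨d, hd⟩ : ∃ d, stepsTo ((face C i).orderEmbOfFin h (proj (face C i) m v)) v = d :=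
    ⟨_, rfl⟩
  induction d using Nat.strong_induction_on generalizing v with
  | _ d ih =>
    by_cases hvf : v ∈ face C i
    · rw [orderEmbOfFin_proj h hvf]
    · obtain ⟨w, hw, hwb, hlt⟩ := exists_step hC hv (mem_face.mp
        (Finset.orderEmbOfFin_mem (face C i) h (proj (face C i) m v))) hvf (by
        -- The next side precedes `v` only when the count is `m + 1`, that is, when all sides of the
        -- face precede `v`.
        intro hlt k hk
        obtain ⟨k, rfl⟩ := exists_orderEmbOfFin h (mem_face.mpr hk)
        rw [orderEmbOfFin_lt_iff] at hlt ⊢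
        rcases Nat.lt_or_ge (cnt (face C i) v) (m + 1) with h' | h'
        · rw [proj_val_of_lt h'] at hlt
          omega
        · omega)
      rw [proj_face_eq h hw] at hlt hd ⊢
      exact (ih _ (hd ▸ hlt) hwb rfl).trans (reachable_of_mem (by rwa [Sym2.eq_swap]))

lemma chordInFace_sameFace (hi : ChordInFace C i c) (hj : ChordInFace C j c) : SameFace C i j :=
  fun a b hab hc => (hi a b hab hc).trans (hj a b hab hc).symm

/-- A chord that crosses no chord of `C` but separates two sides of a face cannot leave that face:
beyond a chord of `C` it would have both sides on the same side of itself. -/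
lemma chordInFace_of_essential (hK : Noncrossing K) (hC : C ⊆ K) (hc : c ∈ K)
    (h : Essential (face C i) c) : ChordInFace C i c ∧ ∀ v ∈ c, OnBoundary C i v := by
  have hcC := not_mem_of_essential_face h
  obtain ⟨j, hj, k, hk, p, q, rfl, hpq, hs⟩ := h
  rw [mem_face] at hj hk
  have key : ∀ a b, a < b → s(a, b) ∈ C → ((a ≤ i ∧ i < b) → (a ≤ p ∧ p ≤ b) ∧ (a ≤ q ∧ q ≤ b)) ∧
      (¬ (a ≤ i ∧ i < b) → ¬ ((a ≤ p ∧ p ≤ b) ∧ (a ≤ q ∧ q ≤ b)) ∧ (p ≤ a ∨ b ≤ p) ∧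
        (q ≤ a ∨ b ≤ q)) := by
    intro a b hab hab'
    have h1 := hj a b hab hab'
    have h2 := hk a b hab hab'
    have n1 := hK.not_lt hc (hC hab')
    have n2 := hK.not_lt (hC hab') hc
    clear hj hk
    have hs' : ((p ≤ j ∧ j < q) ∧ ¬ (p ≤ k ∧ k < q)) ∨ ((p ≤ k ∧ k < q) ∧ ¬ (p ≤ j ∧ j < q)) := by
      by_cases hx : p ≤ j ∧ j < q
      · exact Or.inl ⟨hx, fun hy => hs (iff_of_true hx hy)⟩
      · exact Or.inr ⟨by_contra fun hy => hs (iff_of_false hx hy), hx⟩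
    clear hs
    simp only [Fin.lt_def, Fin.le_def] at *
    by_cases hin : a.1 ≤ i.1 ∧ i.1 < b.1
    · rw [iff_true_left hin] at h1 h2
      refine ⟨fun _ => ?_, fun h => absurd hin h⟩
      clear hin
      rcases hs' with ⟨h3, h4⟩ | ⟨h3, h4⟩ <;> rcases not_and_or.mp h4 with h5 | h5 <;>
        refine ⟨⟨?_, ?_⟩, ?_, ?_⟩ <;> clear h4 <;> omega
    · rw [iff_false_left hin] at h1 h2
      refine ⟨fun h => absurd h hin, fun _ => ?_⟩
      clear hin
      rcases hs' with ⟨h3, h4⟩ | ⟨h3, h4⟩ <;> rcases not_and_or.mp h4 with h5 | h5 <;>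
        refine ⟨?_, ?_, ?_⟩ <;> clear h4 <;> omega
  constructor
  · intro a b hab hab'
    obtain ⟨h1, h2⟩ := key a b hab hab'
    simp only [Sym2.mem_iff, forall_eq_or_imp, forall_eq]
    exact ⟨h1, fun h => by_contra fun h' => (h2 h').1 h⟩
  · intro v hv a b hab hab'
    obtain ⟨h1, h2⟩ := key a b hab hab'
    rcases Sym2.mem_iff.mp hv with rfl | rfl
    · exact ⟨fun h => (h1 h).1, fun h => (h2 h).2.1⟩
    · exact ⟨fun h => (h1 h).2, fun h => (h2 h).2.2⟩

/-- By the counting, each chord of `D` outside `C` is essential for some face; it lies inside that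
face, and it cannot lie inside two. So "inside the face" and "essential for the face" agree on these
chords. -/
lemma Diagram.qChords_eq (D : Diagram n) (hC : C ⊆ D.chords) (i : Fin (n + 1)) :
    D.qChords C i = res (faceDegree C i) (face C i) D.chords := by
  classical
  have h := face_card C i
  have hK : Noncrossing D.chords := D.isDissection.noncrossing
  ext c
  rw [qChords, mem_contract, mem_res]
  constructor
  · rintro ⟨j, k, v, w, rfl, hc, hj, hk⟩
    rw [Finset.mem_filter, Finset.mem_sdiff] at hc
    obtain ⟨⟨hcD, hcC⟩, hin⟩ := hc
    obtain ⟨i', -, he⟩ := exists_essential_face D.isDissection hC hcD hcC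
    have hs := chordInFace_sameFace hin (chordInFace_of_essential hK hC hcD he).1
    rw [← face_eq_of_sameFace hs] at he
    have hproj : ∀ (j : Fin (faceDegree C i + 1)) v,
        (chordGraph C).Reachable (faceSide C i j) v → proj (face C i) (faceDegree C i) v = j := by
      intro j v hr
      refine mem_of_reachable (P := fun v => proj (face C i) (faceDegree C i) v = j) ?_ hr
        (proj_orderEmbOfFin h j)
      intro x y hxy hx
      rw [← hx]
      exact (proj_face_eq h (chordGraph_adj.mp hxy).1).symm
    exact ⟨s(v, w), hcD, he, congrArg₂ (fun x y => s(x, y)) (hproj j v hj) (hproj k w hk)⟩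
  · rintro ⟨d, hd, hess, rfl⟩
    have hb := chordInFace_of_essential hK hC hd hess
    have hdC := not_mem_of_essential_face hess
    induction d with
    | _ v w =>
      exact ⟨_, _, v, w, rfl, Finset.mem_filter.mpr
        ⟨Finset.mem_sdiff.mpr ⟨hd, hdC⟩, hb.1⟩,
        chordGraph_reachable_of_onBoundary (hK.mono hC) h (hb.2 v (Sym2.mem_mk_left v w)),
        chordGraph_reachable_of_onBoundary (hK.mono hC) h (hb.2 w (Sym2.mem_mk_right v w))⟩

theorem wellDefined (D : Diagram n) (hC : C ⊆ D.chords) :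
    restDegree C = C.card ∧ IsDissection (restDegree C) (rChords C) ∧
      (∀ i : Fin (n + 1), IsDissection (faceDegree C i) (D.qChords C i)) ∧
      ∑ i ∈ minSides C, faceDegree C i + C.card = n := by
  have hM := card_minSides D.isDissection hC
  refine ⟨by rw [restDegree, hM, Nat.add_sub_cancel], ?_, fun i => ?_, ?_⟩
  · rw [rChords_eq fun c => essential_minSides D.isDissection hC]
    exact (good_minSides D.isDissection hC).isDissection_res (minSides_card C)
  · rw [D.qChords_eq hC]
    exact (good_face D.isDissection hC i).isDissection_res (face_card C i)
  · have h1 : ∑ i ∈ minSides C, (faceDegree C i + 1) = n + 1 := by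
      exact (Finset.sum_congr rfl fun i _ => (face_card C i).symm).trans sum_card_face
    rw [Finset.sum_add_distrib, Finset.sum_const, smul_eq_mul, mul_one, hM] at h1
    omega

/-! ## Directions of chords -/

/-- The chord `{v, w}` of `K`, oriented towards the root, starts at `v`: this is expressed with two
sides in `S` which are separated only by this chord. -/
def Src (S : Finset (Fin (n + 1))) (K : Finset (Sym2 (Fin (n + 1)))) (v w : Fin (n + 1)) : Prop :=
  ∃ i ∈ S, ∃ j ∈ S, i < j ∧ SameFace (K.erase s(v, w)) i j ∧ (i < v ∧ v ≤ j) ∧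
    ¬ (i < w ∧ w ≤ j)

/-- The chord `c` of `K`, oriented towards the root, goes from its smallest end to the largest. -/
def Up (S : Finset (Fin (n + 1))) (K : Finset (Sym2 (Fin (n + 1)))) (c : Sym2 (Fin (n + 1))) :
    Prop :=
  Src S K c.inf c.sup

open Classical in
/-- The number of flipped chords, for the polygon whose sides are those in `S`. -/
noncomputable def kOn (S : Finset (Fin (n + 1))) (K C : Finset (Sym2 (Fin (n + 1)))) : ℕ :=
  (C.filter fun c => Up S C c ∧ ¬ Up S K c).card

/-- Removing chords can only merge faces, so the witnessing sides remain valid. This is the source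
of the monotonicity of directions. -/
lemma Src.mono (h : Src S K v w) (hST : S ⊆ T) (hC : C ⊆ K) : Src T C v w := by
  obtain ⟨i, hi, j, hj, hij, hs, h⟩ := h
  exact ⟨i, hST hi, j, hST hj, hij, hs.mono (Finset.erase_subset_erase _ hC), h⟩

lemma sep_of_between (hij : i < j) (h1 : i < v ∧ v ≤ j) (h2 : ¬ (i < w ∧ w ≤ j)) :
    Sep i j s(v, w) :=
  (sep_mk hij.le).mpr fun h => h2 (h.mp h1)

lemma sameFace_of_erase (h : SameFace (K.erase c) i j) (hc : ¬ Sep i j c) : SameFace K i j := by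
  rw [sameFace_iff_forall_not_sep] at *
  intro e he
  by_cases hec : e = c
  · rwa [hec]
  · exact h e (Finset.mem_erase.mpr ⟨hec, he⟩)

/-- Without the chord, both pairs of witnesses lie in one face, which the chord divides into two
faces with one side of `S` each. So the pairs have the same elements, and in the same order since
both are increasing; then the arc `(i, j]` would contain both ends. -/
lemma Src.asymm (hK : Noncrossing K) (hS : ∀ i ∈ S, ∀ j ∈ S, SameFace K i j → i = j)
    (hc : s(v, w) ∈ K) (h1 : Src S K v w) : ¬ Src S K w v := by
  rintro ⟨i', hi', j', hj', hij', hs', h3, h4⟩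
  obtain ⟨i, hi, j, hj, hij, hs, h1, h2⟩ := h1
  rw [Sym2.eq_swap] at hs'
  have hsep := sep_of_between hij h1 h2
  have hsep' := sep_of_between hij' h3 h4
  rw [Sym2.eq_swap] at hsep'
  have hii : SameFace (K.erase s(v, w)) i i' := by
    rw [sameFace_iff_forall_not_sep]
    intro e he
    exact not_sep_of_noncrossing hK hc (Finset.mem_of_mem_erase he) hsep hsep' (hs.not_sep he)
      (hs'.not_sep he)
  by_cases hx : Sep i i' s(v, w)
  · have hij2 : ¬ Sep i j' s(v, w) := fun h => hx.not_sep_of_sep h hsep'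
    have hji2 : ¬ Sep j i' s(v, w) := hsep.not_sep_of_sep hx
    have e1 := hS i hi j' hj' (sameFace_of_erase (hii.trans hs') hij2)
    have e2 := hS j hj i' hi' (sameFace_of_erase (hs.symm.trans hii) hji2)
    rw [e1, e2] at hij
    exact lt_asymm hij hij'
  · have e1 := hS i hi i' hi' (sameFace_of_erase hii hx)
    have hjj : ¬ Sep j j' s(v, w) := hsep.not_sep_of_sep (e1 ▸ hsep')
    have e2 := hS j hj j' hj' (sameFace_of_erase (hs.symm.trans (hii.trans hs')) hjj)
    subst e1 e2
    exact h2 h3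

/-- Without `c` there are too few essential chords to separate all the sides in `S`. -/
lemma Good.exists_sameFace_erase (hg : Good S K) (hc : c ∈ K) (hess : Essential S c) :
    ∃ i ∈ S, ∃ j ∈ S, SameFace (K.erase c) i j ∧ Sep i j c := by
  classical
  by_contra hcon
  push Not at hcon
  have h1 := card_le_of_forall_sameFace (hg.noncrossing.mono (Finset.erase_subset c K))
    fun i hi j hj hij => hg.sep i hi j hj (sameFace_of_erase hij (hcon i hi j hj hij))
  have h2 := hg.card
  have h3 : ((K.erase c).filter (Essential S)).card < (K.filter (Essential S)).card := by
    rw [Finset.filter_erase]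
    exact Finset.card_erase_lt_of_mem (Finset.mem_filter.mpr ⟨hc, hess⟩)
  omega

lemma Good.src_or_src (hg : Good S K) (hc : s(v, w) ∈ K) (hess : Essential S s(v, w)) :
    Src S K v w ∨ Src S K w v := by
  obtain ⟨i, hi, j, hj, hs, hsep⟩ := hg.exists_sameFace_erase hc hess
  wlog hij : i < j generalizing i j
  · exact this j hj i hi hs.symm hsep.symm (lt_of_le_of_ne (not_lt.mp hij) hsep.ne.symm)
  rw [sep_mk hij.le] at hsep
  by_cases h1 : i < v ∧ v ≤ j
  · exact Or.inl ⟨i, hi, j, hj, hij, hs, h1, fun h => hsep (iff_of_true h1 h)⟩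
  · refine Or.inr ⟨i, hi, j, hj, hij, by rwa [Sym2.eq_swap], ?_, h1⟩
    exact by_contra fun h => hsep (iff_of_false h1 h)

lemma Good.src_iff (hg : Good S K) (hc : s(v, w) ∈ K) (hess : Essential S s(v, w)) :
    Src S K w v ↔ ¬ Src S K v w :=
  ⟨fun h h' => h'.asymm hg.noncrossing hg.sep hc h, fun h => (hg.src_or_src hc hess).resolve_left h⟩

lemma IsDissection.good_univ (hD : IsDissection n D) : Good Finset.univ D where
  noncrossing := hD.noncrossing
  sep _ _ _ _ h := hD.eq_of_sameFace h
  card := by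
    classical
    rw [Finset.filter_true_of_mem, hD.card_eq, Finset.card_univ, Fintype.card_fin]
    intro c hc
    obtain ⟨i, j, hs⟩ := exists_sep_of_not_isDiag (hD.loopless c hc)
    exact ⟨i, Finset.mem_univ i, j, Finset.mem_univ j, hs⟩

lemma essential_univ (hc : ¬ c.IsDiag) : Essential Finset.univ c := by
  obtain ⟨i, j, hs⟩ := exists_sep_of_not_isDiag hc
  exact ⟨i, Finset.mem_univ i, j, Finset.mem_univ j, hs⟩

lemma Src.directed (hD : IsDissection n D) (hc : s(v, w) ∈ D) (h : Src S D v w) :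
    Directed D v w := by
  obtain ⟨i, -, j, -, hij, hs, h1, h2⟩ := h
  refine ⟨hc, ?_⟩
  -- A walk to the root from inside the arc `(i, j]` must leave it, and the only chord that does so
  -- is `{v, w}`, at `w`. What remains is a strictly shorter walk from `w`.
  have key : ∀ (x y : Fin (n + 1)) (p : (chordGraph D).Walk x y), y = 0 → (i < x ∧ x ≤ j) →
      ∃ q : (chordGraph D).Walk w y, q.length < p.length := by
    intro x y p
    induction p with
    | nil => exact fun h hx => absurd (h ▸ hx.1) (Fin.not_lt_zero i)
    | @cons x z y hadj p ih =>
      intro hy hx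
      by_cases hz : i < z ∧ z ≤ j
      · obtain ⟨q, hq⟩ := ih hy hz
        exact ⟨q, by rw [SimpleGraph.Walk.length_cons]; omega⟩
      · have hxz := (chordGraph_adj.mp hadj).1
        have : s(x, z) = s(v, w) := by
          by_contra hne
          exact hs.not_sep (Finset.mem_erase.mpr ⟨hne, hxz⟩) (sep_of_between hij hx hz)
        rw [Sym2.eq_iff] at this
        rcases this with ⟨-, rfl⟩ | ⟨-, rfl⟩
        · exact ⟨p, by rw [SimpleGraph.Walk.length_cons]; omega⟩
        · exact absurd h1 hz
  have hcon := connected_of_isAcyclic_of_card hD.loopless hD.card_eq hD.acyclic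
  obtain ⟨p, hp⟩ := hcon.exists_walk_length_eq_dist v 0
  obtain ⟨q, hq⟩ := key v 0 p rfl h1
  exact lt_of_le_of_lt (SimpleGraph.dist_le q) (hp ▸ hq)

lemma IsDissection.directed_iff (hD : IsDissection n D) (hc : s(v, w) ∈ D) :
    Directed D v w ↔ Src Finset.univ D v w := by
  refine ⟨fun h => ?_, fun h => h.directed hD hc⟩
  refine (hD.good_univ.src_or_src hc (essential_univ (hD.loopless _ hc))).resolve_right fun h' => ?_
  exact lt_asymm h.2 (h'.directed hD (by rwa [Sym2.eq_swap])).2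

/-! ## Transfer of the directions to the contracted polygon -/

open Classical in
lemma res_erase (hinj : Set.InjOn (Sym2.map (proj S m))
      (K.filter (Essential S) : Finset (Sym2 (Fin (n + 1))))) (hc : c ∈ K)
    (hess : Essential S c) : (res m S K).erase (c.map (proj S m)) = res m S (K.erase c) := by
  ext d
  rw [Finset.mem_erase, mem_res, mem_res]
  constructor
  · rintro ⟨hne, e, he, he', rfl⟩
    exact ⟨e, Finset.mem_erase.mpr ⟨fun h => hne (by rw [h]), he⟩, he', rfl⟩
  · rintro ⟨e, he, he', rfl⟩
    rw [Finset.mem_erase] at he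
    refine ⟨fun h => he.1 (hinj ?_ ?_ h), e, he.2, he', rfl⟩
    · exact Finset.mem_coe.mpr (Finset.mem_filter.mpr ⟨he.2, he'⟩)
    · exact Finset.mem_coe.mpr (Finset.mem_filter.mpr ⟨hc, hess⟩)

open Classical in
lemma src_res (h : S.card = m + 1) (T : Finset (Fin (m + 1)))
    (hinj : Set.InjOn (Sym2.map (proj S m))
      (K.filter (Essential S) : Finset (Sym2 (Fin (n + 1))))) (hc : s(v, w) ∈ K)
    (hess : Essential S s(v, w)) :
    Src T (res m S K) (proj S m v) (proj S m w) ↔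
      Src (T.map (S.orderEmbOfFin h).toEmbedding) K v w := by
  have he : (res m S K).erase s(proj S m v, proj S m w) = res m S (K.erase s(v, w)) :=
    res_erase hinj hc hess
  unfold Src
  simp only [Finset.mem_map, RelEmbedding.coe_toEmbedding, exists_exists_and_eq_and, he,
    sameFace_res h, between_iff h, OrderEmbedding.lt_iff_lt]

lemma minOn_eq_map (h : S.card = m + 1) :
    minOn S C = (minSides (res m S C)).map (S.orderEmbOfFin h).toEmbedding := by
  ext i
  simp only [mem_minOn, Finset.mem_map, mem_minSides, RelEmbedding.coe_toEmbedding,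
    sameFace_res h]
  constructor
  · rintro ⟨hi, hmin⟩
    obtain ⟨i, rfl⟩ := exists_orderEmbOfFin h hi
    exact ⟨i, fun j hj => (OrderEmbedding.le_iff_le _).mp
      (hmin _ (Finset.orderEmbOfFin_mem S h j) hj), rfl⟩
  · rintro ⟨i, hmin, rfl⟩
    refine ⟨Finset.orderEmbOfFin_mem S h i, fun j hj hs => ?_⟩
    obtain ⟨j, rfl⟩ := exists_orderEmbOfFin h hj
    exact (OrderEmbedding.le_iff_le _).mpr (hmin j hs)

lemma map_univ_orderEmbOfFin (h : S.card = m + 1) :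
    Finset.univ.map (S.orderEmbOfFin h).toEmbedding = S := by
  ext i
  simp only [Finset.mem_map, Finset.mem_univ, true_and, RelEmbedding.coe_toEmbedding]
  constructor
  · rintro ⟨j, rfl⟩
    exact Finset.orderEmbOfFin_mem S h j
  · exact exists_orderEmbOfFin h

lemma Diagram.mem_flipped (D : Diagram n) (hC : C ⊆ D.chords) {p : Fin (n + 1) × Fin (n + 1)} :
    p ∈ D.flipped C ↔ s(p.1, p.2) ∈ C ∧ Src Finset.univ D.chords p.1 p.2 ∧
      Src (minSides C) C p.2 p.1 := by
  classical
  have hM := minSides_card C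
  have hess : ∀ c ∈ C, Essential (minSides C) c := fun c => essential_minSides D.isDissection hC
  have hg := good_minSides D.isDissection hC
  have hR : IsDissection (restDegree C) (rChords C) := by
    rw [rChords_eq hess]; exact hg.isDissection_res hM
  simp only [flipped, Set.mem_ofPred_eq]
  refine and_congr_right fun hc => and_congr (D.isDissection.directed_iff (hC hc)) ?_
  have hc' : s(p.2, p.1) ∈ C := by rwa [Sym2.eq_swap]
  have key : Directed (rChords C) (proj (minSides C) (restDegree C) p.2)
      (proj (minSides C) (restDegree C) p.1) ↔ Src (minSides C) C p.2 p.1 := by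
    have hmem : s(proj (minSides C) (restDegree C) p.2, proj (minSides C) (restDegree C) p.1) ∈
        rChords C := by
      rw [rChords_eq hess, mem_res]
      exact ⟨s(p.2, p.1), hc', hess _ hc', rfl⟩
    rw [hR.directed_iff hmem, rChords_eq hess]
    refine (src_res hM Finset.univ (hg.injOn hM) hc' (hess _ hc')).trans ?_
    rw [map_univ_orderEmbOfFin]
  rw [← key]
  constructor
  · rintro ⟨j, k, hj, hk, h⟩
    have e1 := (plusGraph_reachable_iff hM j).mp hj
    have e2 := (plusGraph_reachable_iff hM k).mp hk
    rw [← e1, ← e2] at h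
    exact h
  · intro h
    exact ⟨_, _, (plusGraph_reachable_iff hM _).mpr rfl, (plusGraph_reachable_iff hM _).mpr rfl, h⟩

/-! ## Counting flipped chords -/

lemma inf_sup_mk (c : Sym2 (Fin (n + 1))) : s(c.inf, c.sup) = c := by
  induction c with
  | _ v w =>
    rw [Sym2.inf_mk, Sym2.sup_mk]
    rcases le_total v w with h | h
    · rw [inf_eq_left.mpr h, sup_eq_right.mpr h]
    · rw [inf_eq_right.mpr h, sup_eq_left.mpr h, Sym2.eq_swap]

lemma Up.mono (h : Up S K c) (hST : S ⊆ T) (hC : C ⊆ K) : Up T C c := Src.mono h hST hC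

/-- The witnesses `i` and `j` may be replaced by the minimal sides of their faces: `i` only
decreases, and `j` stays between the two ends because `c` itself belongs to `B`. For a downward
chord `j` is beyond both ends and may drop below them, which is how flips arise. -/
lemma up_minOn (hC : C ⊆ B) (hc : c ∈ C) : Up (minOn S B) C c ↔ Up S C c := by
  refine ⟨fun h => h.mono (fun i hi => (mem_minOn.mp hi).1) subset_rfl, ?_⟩
  rintro ⟨i, hi, j, hj, hij, hs, h1, h2⟩
  obtain ⟨i', hi', his, hle⟩ := exists_mem_minOn (C := B) hi
  obtain ⟨j', hj', hjs, -⟩ := exists_mem_minOn (C := B) hj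
  have h3 : j < c.sup := by
    by_contra h
    exact h2 ⟨lt_of_lt_of_le h1.1 c.inf_le_sup, not_lt.mp h⟩
  have h4 := (hjs.mono hC) c.inf c.sup (lt_of_le_of_lt h1.2 h3) (by rwa [inf_sup_mk])
  obtain ⟨h5, h6⟩ := h4.mpr ⟨h1.2, h3⟩
  refine ⟨i', hi', j', hj', ?_, ?_, ⟨lt_of_le_of_lt hle h1.1, h5⟩, fun h => ?_⟩
  · exact lt_of_le_of_lt hle (lt_of_lt_of_le h1.1 h5)
  · have hsub := (Finset.erase_subset s(c.inf, c.sup) C).trans hC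
    exact (his.mono hsub).trans (hs.trans (hjs.mono hsub).symm)
  · exact absurd h6 (not_lt.mpr h.2)

/-- The two witnesses are separated by `c` alone, which is not in `C`, so they lie in one face of
`C`. As `c` separates them, this is the only face for which `c` is essential. -/
lemma up_face (hK : Noncrossing K) (hC : C ⊆ K) (hc : c ∈ K) (hess : Essential (face C i) c) :
    Up (face C i) K c ↔ Up Finset.univ K c := by
  refine ⟨fun h => h.mono (Finset.subset_univ _) subset_rfl, ?_⟩
  rintro ⟨j, -, k, -, hjk, hs, h1, h2⟩
  have hsub : C ⊆ K.erase c := fun e he =>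
    Finset.mem_erase.mpr ⟨fun h => not_mem_of_essential_face hess (h ▸ he), hC he⟩
  have hsep := sep_of_between hjk h1 h2
  rw [inf_sup_mk] at hs hsep
  have hsC := hs.mono hsub
  have hj : SameFace C i j := sameFace_of_essential hK hC hc hess
    ⟨j, self_mem_face, k, mem_face.mpr hsC, hsep⟩
  exact ⟨j, mem_face.mpr hj, k, mem_face.mpr (hj.trans hsC), hjk, by rwa [inf_sup_mk], h1, h2⟩

open Classical in
lemma sameFace_filter_essential (hi : i ∈ S) (hj : j ∈ S) :
    SameFace (K.filter (Essential S)) i j ↔ SameFace K i j := by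
  refine ⟨fun h => ?_, fun h => h.mono (Finset.filter_subset _ _)⟩
  rw [sameFace_iff_forall_not_sep] at *
  intro c hc hs
  exact h c (Finset.mem_filter.mpr ⟨hc, i, hi, j, hj, hs⟩) hs

open Classical in
lemma src_filter_essential : Src S (K.filter (Essential S)) v w ↔ Src S K v w := by
  unfold Src
  refine exists_congr fun i => and_congr_right fun hi => exists_congr fun j =>
    and_congr_right fun hj => and_congr_right fun _ => and_congr_left fun _ => ?_
  rw [← Finset.filter_erase, sameFace_filter_essential hi hj]

/-- The number of flipped chords of a contracted dissection diagram. -/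
lemma Good.k_res (hg : Good S K) (h : S.card = m + 1) (hC : C ⊆ K)
    (hess : ∀ c ∈ C, Essential S c) :
    (Diagram.mk (res m S K) (hg.isDissection_res h)).k (res m S C) = kOn S K C := by
  classical
  have hinj := hg.injOn h
  have hinjC : Set.InjOn (Sym2.map (proj S m))
      (C.filter (Essential S) : Finset (Sym2 (Fin (n + 1)))) :=
    hinj.mono (Finset.coe_subset.mpr (Finset.filter_subset_filter _ hC))
  have hsub : res m S C ⊆ res m S K :=
    Finset.image_subset_image (Finset.filter_subset_filter _ hC)
  set F : Set (Fin (n + 1) × Fin (n + 1)) :=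
    {p | s(p.1, p.2) ∈ C ∧ Src S K p.1 p.2 ∧ Src (minOn S C) C p.2 p.1} with hF
  have hpair : ∀ v w, s(v, w) ∈ C → proj S m v ≠ proj S m w := by
    intro v w hc heq
    have := (essential_iff h).mp (hess _ hc)
    rw [Sym2.map_mk] at this
    exact this heq
  have himage : (Diagram.mk (res m S K) (hg.isDissection_res h)).flipped (res m S C) =
      Prod.map (proj S m) (proj S m) '' F := by
    have tr1 : ∀ v w, s(v, w) ∈ C → (Src Finset.univ (res m S K) (proj S m v) (proj S m w) ↔
        Src S K v w) := fun v w hc => by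
      rw [src_res h Finset.univ hinj (hC hc) (hess _ hc), map_univ_orderEmbOfFin]
    have tr2 : ∀ v w, s(v, w) ∈ C → (Src (minSides (res m S C)) (res m S C) (proj S m w)
        (proj S m v) ↔ Src (minOn S C) C w v) := fun v w hc => by
      have hc' : s(w, v) ∈ C := by rwa [Sym2.eq_swap]
      rw [src_res h _ hinjC hc' (hess _ hc'), minOn_eq_map h]
    ext ⟨x, y⟩
    rw [Diagram.mem_flipped _ hsub]
    constructor
    · rintro ⟨hxy, h1, h2⟩
      obtain ⟨c, hc, -, he⟩ := mem_res.mp hxy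
      induction c with
      | _ v w =>
        rw [Sym2.map_mk, Sym2.eq_iff] at he
        rcases he with ⟨rfl, rfl⟩ | ⟨rfl, rfl⟩
        · exact ⟨(v, w), ⟨hc, (tr1 v w hc).mp h1, (tr2 v w hc).mp h2⟩, rfl⟩
        · rw [Sym2.eq_swap] at hc
          exact ⟨(w, v), ⟨hc, (tr1 w v hc).mp h1, (tr2 w v hc).mp h2⟩, rfl⟩
    · rintro ⟨⟨v, w⟩, ⟨hc, h1, h2⟩, he⟩
      obtain ⟨rfl, rfl⟩ := Prod.mk.inj he
      exact ⟨mem_res.mpr ⟨_, hc, hess _ hc, rfl⟩, (tr1 v w hc).mpr h1, (tr2 v w hc).mpr h2⟩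
  have hFinj : Set.InjOn (Prod.map (proj S m) (proj S m)) F := by
    rintro ⟨v, w⟩ ⟨hc, -⟩ ⟨v', w'⟩ ⟨hc', -⟩ he
    obtain ⟨e1, e2⟩ := Prod.mk.inj he
    have : s(v, w) = s(v', w') := by
      refine hinjC (Finset.mem_coe.mpr (Finset.mem_filter.mpr ⟨hc, hess _ hc⟩))
        (Finset.mem_coe.mpr (Finset.mem_filter.mpr ⟨hc', hess _ hc'⟩)) ?_
      exact congrArg₂ (fun x y => s(x, y)) e1 e2
    rw [Sym2.eq_iff] at this
    rcases this with ⟨rfl, rfl⟩ | ⟨rfl, rfl⟩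
    · rfl
    · exact absurd e1 (hpair _ _ hc)
  have hasymm : ∀ v w, s(v, w) ∈ C → Src (minOn S C) C v w → ¬ Src (minOn S C) C w v :=
    fun v w hc => Src.asymm (hg.noncrossing.mono hC) (fun i hi j hj => eq_of_mem_minOn hi hj) hc
  have hcount : Set.InjOn (fun p : Fin (n + 1) × Fin (n + 1) => s(p.1, p.2)) F ∧
      (fun p : Fin (n + 1) × Fin (n + 1) => s(p.1, p.2)) '' F =
        (C.filter fun c => Up S C c ∧ ¬ Up S K c : Finset (Sym2 (Fin (n + 1)))) := by
    constructor
    · rintro ⟨v, w⟩ ⟨hc, h1, -⟩ ⟨v', w'⟩ ⟨hc', h2, -⟩ he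
      rcases Sym2.eq_iff.mp he with ⟨h3, h4⟩ | ⟨h3, h4⟩
      · exact Prod.ext h3 h4
      · obtain rfl : v = w' := h3
        obtain rfl : w = v' := h4
        exact absurd h2 (h1.asymm hg.noncrossing hg.sep (hC hc))
    · ext c
      have hmk := inf_sup_mk c
      rw [Finset.mem_coe, Finset.mem_filter]
      constructor
      · rintro ⟨⟨v, w⟩, ⟨hc, h1, h2⟩, rfl⟩
        refine ⟨hc, ?_⟩
        dsimp only at hc h1 h2 hmk ⊢
        rw [← up_minOn subset_rfl hc]
        rcases Sym2.eq_iff.mp hmk with ⟨e1, e2⟩ | ⟨e1, e2⟩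
        -- A chord that is upward in `K` stays upward in `C`, so it is not flipped.
        · exfalso
          have : Up S K s(v, w) := by rw [Up, e1, e2]; exact h1
          have h3 := (up_minOn subset_rfl hc).mpr (this.mono subset_rfl hC)
          rw [Up, e1, e2] at h3
          exact hasymm v w hc h3 h2
        · rw [Up, Up, e1, e2]
          exact ⟨h2, h1.asymm hg.noncrossing hg.sep (hC hc)⟩
      · rintro ⟨hc, h1, h2⟩
        rw [← up_minOn subset_rfl hc] at h1
        have hmem : s(c.inf, c.sup) ∈ C := by rwa [hmk]
        refine ⟨(c.sup, c.inf), ⟨by rwa [Sym2.eq_swap], ?_, h1⟩, Sym2.eq_swap.trans hmk⟩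
        exact (hg.src_iff (hC hmem) (hess _ hmem)).mpr h2
  rw [Diagram.k, himage, hFinj.ncard_image, ← hcount.1.ncard_image,
    hcount.2, Set.ncard_coe_finset, kOn]

/-- The numbers of flipped chords are compatible with extracting in two steps. -/
lemma kOn_add (hD : IsDissection n D) (hB : B ⊆ D) (hC : C ⊆ B) :
    kOn Finset.univ D C + ∑ i ∈ minSides C, kOn (face C i) D
      (open Classical in B.filter (Essential (face C i))) =
      kOn Finset.univ D B + kOn (minSides B) B C := by
  classical
  have hKD : Noncrossing D := hD.noncrossing
  have hKB := hKD.mono hB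
  have h1 : ∀ i, kOn (face C i) D (B.filter (Essential (face C i))) =
      ((B.filter fun c => Up Finset.univ B c ∧ ¬ Up Finset.univ D c).filter
        (Essential (face C i))).card := by
    intro i
    rw [kOn, Finset.filter_filter, Finset.filter_filter]
    congr 1
    refine Finset.filter_congr fun c hc => ?_
    have : ∀ hess : Essential (face C i) c,
        (Up (face C i) (B.filter (Essential (face C i))) c ↔ Up Finset.univ B c) ∧
        (Up (face C i) D c ↔ Up Finset.univ D c) := by
      intro hess
      refine ⟨?_, up_face hKD (hC.trans hB) (hB hc) hess⟩
      rw [← up_face hKB hC hc hess]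
      exact src_filter_essential
    constructor
    · rintro ⟨hess, h⟩
      rw [(this hess).1, (this hess).2] at h
      exact ⟨h, hess⟩
    · rintro ⟨h, hess⟩
      rw [← (this hess).1, ← (this hess).2] at h
      exact ⟨hess, h⟩
  -- Each chord of `B \ C` is essential for exactly one face of `C`, and its directions can be
  -- computed in that face, so the flips in the faces are those of the chords in `B \ C`.
  have h2 : ∑ i ∈ minSides C, kOn (face C i) D (B.filter (Essential (face C i))) =
      ((B \ C).filter fun c => Up Finset.univ B c ∧ ¬ Up Finset.univ D c).card := by
    rw [Finset.sum_congr rfl fun i _ => h1 i, ← Finset.card_biUnion]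
    · congr 1
      ext c
      simp only [Finset.mem_biUnion, Finset.mem_filter, Finset.mem_sdiff]
      constructor
      · rintro ⟨i, -, ⟨hc, h⟩, hess⟩
        exact ⟨⟨hc, not_mem_of_essential_face hess⟩, h⟩
      · rintro ⟨⟨hc, hcC⟩, h⟩
        obtain ⟨i, hi, hess⟩ := exists_essential_face hD (hC.trans hB) (hB hc) hcC
        exact ⟨i, hi, ⟨hc, h⟩, hess⟩
    · intro i hi j hj hij
      refine Finset.disjoint_left.mpr fun c hc hc' => hij ?_
      rw [Finset.mem_filter, Finset.mem_filter] at hc hc'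
      exact eq_of_mem_minSides hi hj (sameFace_of_essential hKB hC hc.1.1 hc.2 hc'.2)
  have h3 : kOn (minSides B) B C =
      (C.filter fun c => Up Finset.univ C c ∧ ¬ Up Finset.univ B c).card := by
    rw [kOn, ← minOn_univ]
    congr 1
    refine Finset.filter_congr fun c hc => ?_
    rw [up_minOn hC hc, up_minOn subset_rfl (hC hc)]
  have h4 : kOn Finset.univ D B =
      (C.filter fun c => Up Finset.univ B c ∧ ¬ Up Finset.univ D c).card +
      ((B \ C).filter fun c => Up Finset.univ B c ∧ ¬ Up Finset.univ D c).card := by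
    rw [kOn, ← Finset.card_union_of_disjoint, ← Finset.filter_union,
      Finset.union_sdiff_of_subset hC]
    exact Finset.disjoint_filter_filter Finset.disjoint_sdiff
  -- Upward in `D` implies upward in `B`, which implies upward in `C`: a chord of `C` flipped
  -- between `D` and `C` is flipped in exactly one of the two stages.
  have h5 : kOn Finset.univ D C =
      (C.filter fun c => Up Finset.univ B c ∧ ¬ Up Finset.univ D c).card +
      (C.filter fun c => Up Finset.univ C c ∧ ¬ Up Finset.univ B c).card := by
    rw [kOn, ← Finset.card_union_of_disjoint, ← Finset.filter_or]
    · congr 1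
      refine Finset.filter_congr fun c _ => ?_
      have m1 : Up Finset.univ D c → Up Finset.univ B c := fun h => h.mono subset_rfl hB
      have m2 : Up Finset.univ B c → Up Finset.univ C c := fun h => h.mono subset_rfl hC
      tauto
    · exact Finset.disjoint_filter.mpr fun c _ h h' => h'.2 h.1
  omega

/-! ## The coproduct -/

/-- The element of `DAlg` given by the contraction to the sides in `S`. -/
noncomputable def aOn (S : Finset (Fin (n + 1))) (K : Finset (Sym2 (Fin (n + 1)))) : DAlg :=
  chordsToAlg (S.card - 1) (res (S.card - 1) S K)

lemma aOn_eq (h : S.card = m + 1) (K : Finset (Sym2 (Fin (n + 1)))) :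
    aOn S K = chordsToAlg m (res m S K) := by
  obtain rfl : m = S.card - 1 := by omega
  rfl

lemma Good.aOn_eq_toAlg (hg : Good S K) (h : S.card = m + 1) :
    aOn S K = (Diagram.mk (res m S K) (hg.isDissection_res h)).toAlg := by
  rw [aOn_eq h, chordsToAlg, dif_pos (hg.isDissection_res h)]

lemma aOn_res (h : S.card = m + 1) {T : Finset (Fin (m + 1))} (hT : T.Nonempty) :
    aOn T (res m S K) = aOn (T.map (S.orderEmbOfFin h).toEmbedding) K := by
  have hT' : T.card = (T.card - 1) + 1 := by have := hT.card_pos; omega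
  rw [aOn_eq hT', aOn_eq (m := T.card - 1) (by rw [Finset.card_map]; exact hT'), res_res h T hT']

open Classical in
lemma aOn_filter_essential (hST : S ⊆ T) : aOn S (K.filter (Essential T)) = aOn S K := by
  rw [aOn, aOn, res, res, Finset.filter_filter]
  congr 2
  refine Finset.filter_congr fun c _ => ?_
  exact ⟨fun h => h.2, fun h => ⟨h.mono hST, h⟩⟩

lemma Diagram.q_eq (D : Diagram n) (hC : C ⊆ D.chords) :
    D.q C = ∏ i ∈ minSides C, aOn (face C i) D.chords := by
  refine Finset.prod_congr rfl fun i _ => ?_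
  rw [aOn_eq (face_card C i), D.qChords_eq hC]
  rfl

lemma r_eq (hD : IsDissection n D) (hC : C ⊆ D) : r C = aOn (minSides C) C := by
  rw [aOn_eq (minSides_card C), r, rChords_eq fun c => essential_minSides hD hC]
  rfl

lemma Diagram.toAlg_eq_one (D : Diagram n) (h : n = 0) : D.toAlg = 1 := by
  rw [toAlg, dif_neg (by omega)]

lemma chordsToAlg_eq_one {K : Finset (Sym2 (Fin (m + 1)))} (hK : IsDissection m K) (h : m = 0) :
    chordsToAlg m K = 1 := by
  rw [chordsToAlg, dif_pos hK, Diagram.toAlg_eq_one _ h]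

lemma Diagram.k_empty (D : Diagram n) : D.k ∅ = 0 := by
  have : D.flipped ∅ = ∅ := by
    ext p
    simp [flipped]
  rw [k, this, Set.ncard_empty]

/-- The defining formula must also be checked in degree `0`, where the diagram is `1` and not a
generator. -/
lemma coproduct_toAlg (x : ℚ) (D : Diagram n) :
    coproduct x D.toAlg =
      ∑ C ∈ D.chords.powerset, (x ^ D.k C) • (D.q C ⊗ₜ[ℚ] r C) := by
  rcases Nat.eq_zero_or_pos n with h | h
  · have hD : D.chords = ∅ := by
      rw [← Finset.card_eq_zero, D.isDissection.card_eq, h]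
    obtain ⟨h1, h2, h3, h4⟩ := wellDefined D (Finset.empty_subset D.chords)
    rw [D.toAlg_eq_one h, map_one, hD, Finset.powerset_empty, Finset.sum_singleton, D.k_empty,
      pow_zero, one_smul, r, chordsToAlg_eq_one h2 (by rw [h1, Finset.card_empty]), Diagram.q,
      Finset.prod_eq_one, Algebra.TensorProduct.one_def]
    intro i hi
    refine chordsToAlg_eq_one (h3 i) ?_
    have := Finset.single_le_sum (f := faceDegree (∅ : Finset (Sym2 (Fin (n + 1)))))
      (fun j _ => Nat.zero_le _) hi
    omega
  · rw [Diagram.toAlg, dif_pos h, coproduct, MvPolynomial.aeval_X]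

lemma map_face_res (h : S.card = m + 1) (i : Fin (m + 1)) :
    (face (res m S C) i).map (S.orderEmbOfFin h).toEmbedding =
      face C (S.orderEmbOfFin h i) ∩ S := by
  ext j
  simp only [Finset.mem_map, mem_face, Finset.mem_inter, RelEmbedding.coe_toEmbedding,
    sameFace_res h]
  constructor
  · rintro ⟨j, hs, rfl⟩
    exact ⟨hs, Finset.orderEmbOfFin_mem S h j⟩
  · rintro ⟨hs, hj⟩
    obtain ⟨j, rfl⟩ := exists_orderEmbOfFin h hj
    exact ⟨j, hs, rfl⟩

open Classical in
-- Contraction is a bijection from the essential chords of `K` to the chords of the contracted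
-- diagram, so its coproduct can be written with sets of chords and of sides of the original
-- polygon.
lemma Good.coproduct_aOn (x : ℚ) (hg : Good S K) :
    coproduct x (aOn S K) = ∑ C ∈ (K.filter (Essential S)).powerset, (x ^ kOn S K C) •
      ((∏ i ∈ minOn S C, aOn (face C i ∩ S) K) ⊗ₜ[ℚ] aOn (minOn S C) C) := by
  have h : S.card = (K.filter (Essential S)).card + 1 := hg.card.symm
  set m := (K.filter (Essential S)).card with hm
  have hres : ∀ C ∈ (K.filter (Essential S)).powerset,
      res m S C = C.image (Sym2.map (proj S m)) := by
    intro C hC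
    rw [res, Finset.filter_true_of_mem]
    exact fun c hc => (Finset.mem_filter.mp (Finset.mem_powerset.mp hC hc)).2
  rw [hg.aOn_eq_toAlg h, coproduct_toAlg]
  symm
  refine Finset.sum_bij (fun C _ => res m S C) ?_ ?_ ?_ ?_
  · intro C hC
    rw [hres C hC, Finset.mem_powerset]
    exact Finset.image_subset_image (Finset.mem_powerset.mp hC)
  · intro C hC C' hC' heq
    rw [hres C hC, hres C' hC'] at heq
    rw [Finset.mem_powerset] at hC hC'
    have := (hg.injOn h).image_eq_image_iff (Finset.coe_subset.mpr hC) (Finset.coe_subset.mpr hC')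
    rw [← Finset.coe_image, ← Finset.coe_image, heq] at this
    exact Finset.coe_injective (this.mp rfl)
  · intro C' hC'
    obtain ⟨C, hC, rfl⟩ := Finset.subset_image_iff.mp (Finset.mem_powerset.mp hC')
    have hC2 := Finset.mem_powerset.mpr hC
    exact ⟨C, hC2, hres C hC2⟩
  · intro C hC
    have hC' := Finset.mem_powerset.mp hC
    have hCK : C ⊆ K := hC'.trans (Finset.filter_subset _ _)
    have hsub : res m S C ⊆ res m S K :=
      Finset.image_subset_image (Finset.filter_subset_filter _ hCK)
    rw [hg.k_res h hCK fun c hc => (Finset.mem_filter.mp (hC' hc)).2, Diagram.q_eq _ hsub,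
      r_eq (hg.isDissection_res h) hsub, aOn_res h ⟨0, zero_mem_minSides⟩, ← minOn_eq_map h]
    congr 2
    rw [minOn_eq_map h, Finset.prod_map]
    refine Finset.prod_congr rfl fun i _ => ?_
    rw [aOn_res h ⟨i, self_mem_face⟩, map_face_res h]
    rfl

/-! ## Extracting in two steps -/

/-- Choosing a subset of each of several disjoint sets amounts to choosing a subset of their union.
-/
lemma prod_sum_powerset {ι α R : Type*} [DecidableEq ι] [DecidableEq α] [CommSemiring R]
    (s : Finset ι) (t : ι → Finset α) (ht : Set.PairwiseDisjoint (s : Set ι) t)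
    (f : ι → Finset α → R) :
    ∏ i ∈ s, ∑ B ∈ (t i).powerset, f i B =
      ∑ B ∈ (s.biUnion t).powerset, ∏ i ∈ s, f i (B ∩ t i) := by
  induction s using Finset.induction_on with
  | empty => simp
  | insert a s ha ih =>
    have hdisj : Disjoint (t a) (s.biUnion t) := by
      rw [Finset.disjoint_biUnion_right]
      intro i hi
      exact ht (by simp) (by simp [hi]) (fun h => ha (h ▸ hi))
    rw [Finset.prod_insert ha, ih (ht.subset (by simp)), Finset.biUnion_insert,
      Finset.sum_mul_sum, ← Finset.sum_product']
    refine Finset.sum_bij' (fun p _ => p.1 ∪ p.2) (fun B _ => (B ∩ t a, B ∩ s.biUnion t))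
      ?_ ?_ ?_ ?_ ?_
    · intro p hp
      rw [Finset.mem_product, Finset.mem_powerset, Finset.mem_powerset] at hp
      exact Finset.mem_powerset.mpr (Finset.union_subset_union hp.1 hp.2)
    · intro B _
      rw [Finset.mem_product, Finset.mem_powerset, Finset.mem_powerset]
      exact ⟨Finset.inter_subset_right, Finset.inter_subset_right⟩
    · rintro ⟨P, Q⟩ hp
      rw [Finset.mem_product, Finset.mem_powerset, Finset.mem_powerset] at hp
      have h1 : Disjoint Q (t a) := (hdisj.mono_right hp.2).symm
      have h2 : Disjoint P (s.biUnion t) := hdisj.mono_left hp.1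
      simp only [Finset.union_inter_distrib_right, Finset.inter_eq_left.mpr hp.1,
        Finset.inter_eq_left.mpr hp.2, Finset.disjoint_iff_inter_eq_empty.mp h1,
        Finset.disjoint_iff_inter_eq_empty.mp h2, Finset.union_empty, Finset.empty_union]
    · intro B hB
      dsimp only
      rw [← Finset.inter_union_distrib_left]
      exact Finset.inter_eq_left.mpr (Finset.mem_powerset.mp hB)
    · rintro ⟨P, Q⟩ hp
      rw [Finset.mem_product, Finset.mem_powerset, Finset.mem_powerset] at hp
      have h1 : Disjoint Q (t a) := (hdisj.mono_right hp.2).symm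
      rw [Finset.prod_insert ha]
      dsimp only
      congr 1
      · rw [Finset.union_inter_distrib_right, Finset.inter_eq_left.mpr hp.1,
          Finset.disjoint_iff_inter_eq_empty.mp h1, Finset.union_empty]
      · refine Finset.prod_congr rfl fun i hi => ?_
        have h2 : Disjoint P (t i) :=
          (hdisj.mono_right (Finset.subset_biUnion_of_mem t hi)).mono_left hp.1
        rw [Finset.union_inter_distrib_right, Finset.disjoint_iff_inter_eq_empty.mp h2,
          Finset.empty_union]

lemma prod_tmul_prod {ι R A : Type*} [CommSemiring R] [CommSemiring A] [Algebra R A]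
    (s : Finset ι) (f g : ι → A) :
    ∏ i ∈ s, (f i ⊗ₜ[R] g i) = (∏ i ∈ s, f i) ⊗ₜ[R] (∏ i ∈ s, g i) := by
  classical
  induction s using Finset.induction_on with
  | empty => simp [Algebra.TensorProduct.one_def]
  | insert a s ha ih =>
    rw [Finset.prod_insert ha, Finset.prod_insert ha, Finset.prod_insert ha, ih,
      Algebra.TensorProduct.tmul_mul_tmul]

lemma face_subset_of_mem (hC : C ⊆ B) (hj : j ∈ face C i) : face B j ⊆ face C i := by
  intro k hk
  rw [mem_face] at *
  exact hj.trans (hk.mono hC)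

open Classical in
lemma face_filter_inter (hC : C ⊆ B) (hj : j ∈ face C i) :
    face (B.filter (Essential (face C i))) j ∩ face C i = face B j := by
  ext k
  rw [Finset.mem_inter, mem_face]
  constructor
  · rintro ⟨h, hk⟩
    exact mem_face.mpr ((sameFace_filter_essential hj hk).mp h)
  · intro hk
    have hk' := face_subset_of_mem hC hj hk
    exact ⟨(sameFace_filter_essential hj hk').mpr (mem_face.mp hk), hk'⟩

open Classical in
lemma minOn_face_filter (hC : C ⊆ B) :
    minOn (face C i) (B.filter (Essential (face C i))) = minSides B ∩ face C i := by
  ext j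
  rw [mem_minOn, Finset.mem_inter, mem_minSides]
  constructor
  · rintro ⟨hj, h⟩
    refine ⟨fun k hk => ?_, hj⟩
    have hk' := face_subset_of_mem hC hj (mem_face.mpr hk)
    exact h k hk' ((sameFace_filter_essential hj hk').mpr hk)
  · rintro ⟨h, hj⟩
    exact ⟨hj, fun k hk hs => h k ((sameFace_filter_essential hj hk).mp hs)⟩

/-- Each face of `C` is a union of faces of `B`, so its minimal side is the minimum of theirs. -/
lemma minOn_minSides (hC : C ⊆ B) : minOn (minSides B) C = minSides C := by
  ext i
  rw [mem_minOn, mem_minSides (C := C)]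
  constructor
  · rintro ⟨-, h⟩ j hs
    obtain ⟨k, hk, hks, hle⟩ := exists_mem_minSides B j
    exact (h k hk (hs.trans (hks.mono hC).symm)).trans hle
  · intro h
    exact ⟨mem_minSides.mpr fun j hs => h j (hs.mono hC), fun j _ hs => h j hs⟩

open Classical in
lemma prod_minSides (B C : Finset (Sym2 (Fin (n + 1)))) (f : Fin (n + 1) → DAlg) :
    ∏ i ∈ minSides C, ∏ j ∈ minSides B ∩ face C i, f j = ∏ j ∈ minSides B, f j := by
  have h : minSides B = (minSides C).biUnion fun i => minSides B ∩ face C i := by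
    ext j
    simp only [Finset.mem_biUnion, Finset.mem_inter]
    constructor
    · intro hj
      obtain ⟨k, hk, hks, -⟩ := exists_mem_minSides C j
      exact ⟨k, hk, hj, mem_face.mpr hks⟩
    · rintro ⟨i, -, hj, -⟩
      exact hj
  conv_rhs => rw [h]
  rw [Finset.prod_biUnion]
  intro i hi j hj hij
  refine Finset.disjoint_left.mpr fun k hk hk' => hij ?_
  exact eq_of_mem_minSides hi hj ((mem_face.mp (Finset.mem_inter.mp hk).2).trans
    (mem_face.mp (Finset.mem_inter.mp hk').2).symm)

open Classical in
/-- The middle factor of the iterated coproduct. -/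
noncomputable def midFactor (B C : Finset (Sym2 (Fin (n + 1)))) : DAlg :=
  ∏ i ∈ minSides C, aOn (minSides B ∩ face C i) B

open Classical in
-- The sets chosen inside the faces of `C` form an arbitrary `B' ⊆ D \ C`, that is, an arbitrary `B
-- = C ∪ B'` between `C` and `D`. The faces of `B` are grouped by the faces of `C` containing them,
-- so the left factors multiply to `q_B(D)`.
lemma coproduct_q (x : ℚ) (D : Diagram n) (hC : C ⊆ D.chords) :
    coproduct x (D.q C) = ∑ B ∈ Finset.Icc C D.chords,
      x ^ (∑ i ∈ minSides C, kOn (face C i) D.chords (B.filter (Essential (face C i)))) •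
        (D.q B ⊗ₜ[ℚ] midFactor B C) := by
  rw [D.q_eq hC, map_prod, Finset.prod_congr rfl fun i _ =>
      (good_face D.isDissection hC i).coproduct_aOn x,
    prod_sum_powerset _ _ (disjoint_essential D.isDissection.noncrossing hC),
    biUnion_essential D.isDissection hC, Finset.Icc_eq_image_powerset hC, Finset.sum_image]
  · refine Finset.sum_congr rfl fun B' hB' => ?_
    rw [Finset.mem_powerset] at hB'
    set B := C ∪ B' with hB
    have hCB : C ⊆ B := Finset.subset_union_left
    have hBD : B ⊆ D.chords := Finset.union_subset hC (hB'.trans Finset.sdiff_subset)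
    have hfil : ∀ i, B' ∩ D.chords.filter (Essential (face C i)) =
        B.filter (Essential (face C i)) := by
      intro i
      ext c
      simp only [Finset.mem_inter, Finset.mem_filter, hB, Finset.mem_union]
      constructor
      · rintro ⟨h1, h2, h3⟩
        exact ⟨Or.inr h1, h3⟩
      · rintro ⟨h1 | h1, h2⟩
        · exact absurd h1 (not_mem_of_essential_face h2)
        · exact ⟨h1, (hB'.trans Finset.sdiff_subset) h1, h2⟩
    have hterm : ∀ i ∈ minSides C,
        (x ^ kOn (face C i) D.chords (B' ∩ D.chords.filter (Essential (face C i)))) •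
          ((∏ j ∈ minOn (face C i) (B' ∩ D.chords.filter (Essential (face C i))),
            aOn (face (B' ∩ D.chords.filter (Essential (face C i))) j ∩ face C i) D.chords) ⊗ₜ[ℚ]
          aOn (minOn (face C i) (B' ∩ D.chords.filter (Essential (face C i))))
            (B' ∩ D.chords.filter (Essential (face C i)))) =
        (x ^ kOn (face C i) D.chords (B.filter (Essential (face C i)))) •
          ((∏ j ∈ minSides B ∩ face C i, aOn (face B j) D.chords) ⊗ₜ[ℚ]
          aOn (minSides B ∩ face C i) B) := by
      intro i _
      rw [hfil i, minOn_face_filter hCB, aOn_filter_essential Finset.inter_subset_right]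
      congr 2
      refine Finset.prod_congr rfl fun j hj => ?_
      rw [face_filter_inter hCB (Finset.mem_inter.mp hj).2]
    rw [Finset.prod_congr rfl hterm, Finset.prod_smul, Finset.prod_pow_eq_pow_sum,
      prod_tmul_prod, prod_minSides, D.q_eq hBD]
    rfl
  · intro P hP Q hQ heq
    rw [Finset.mem_coe, Finset.mem_powerset] at hP hQ
    have h1 : Disjoint C P := Finset.disjoint_of_subset_right hP Finset.disjoint_sdiff
    have h2 : Disjoint C Q := Finset.disjoint_of_subset_right hQ Finset.disjoint_sdiff
    dsimp only at heq
    rw [← Finset.union_sdiff_cancel_left h1, heq, Finset.union_sdiff_cancel_left h2]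

open Classical in
lemma coproduct_r (x : ℚ) (hD : IsDissection n D) (hB : B ⊆ D) :
    coproduct x (r B) = ∑ C ∈ B.powerset, x ^ kOn (minSides B) B C •
      (midFactor B C ⊗ₜ[ℚ] r C) := by
  rw [r_eq hD hB, (good_minSides hD hB).coproduct_aOn x,
    Finset.filter_true_of_mem fun c hc => essential_minSides hD hB hc]
  refine Finset.sum_congr rfl fun C hC => ?_
  rw [Finset.mem_powerset] at hC
  rw [minOn_minSides hC, r_eq hD (hC.trans hB), midFactor]
  simp only [Finset.inter_comm]

lemma Diagram.k_eq (D : Diagram n) (hC : C ⊆ D.chords) : D.k C = kOn Finset.univ D.chords C := by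
  have h : (Finset.univ : Finset (Fin (n + 1))).card = n + 1 := by simp
  have hl := D.isDissection.loopless
  rw [← D.isDissection.good_univ.k_res h hC fun c hc => essential_univ (hl c (hC hc))]
  have e1 : res n Finset.univ D.chords = D.chords := res_univ hl
  have e2 : res n Finset.univ C = C := res_univ fun c hc => hl c (hC hc)
  cases D
  simp only [e2]
  congr
  exact e1.symm

theorem coproduct_coassoc (x : ℚ) :
    (Algebra.TensorProduct.assoc ℚ ℚ ℚ DAlg DAlg DAlg).toAlgHom.comp
      ((Algebra.TensorProduct.map (coproduct x) (AlgHom.id ℚ DAlg)).comp (coproduct x)) =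
        (Algebra.TensorProduct.map (AlgHom.id ℚ DAlg) (coproduct x)).comp (coproduct x) := by
  classical
  refine MvPolynomial.algHom_ext fun ⟨⟨n, D⟩, hn⟩ => ?_
  have hX : (MvPolynomial.X ⟨⟨n, D⟩, hn⟩ : DAlg) = D.toAlg := by
    rw [Diagram.toAlg, dif_pos hn]
  have hL : ∀ C ∈ D.chords.powerset, (Algebra.TensorProduct.assoc ℚ ℚ ℚ DAlg DAlg DAlg)
      ((x ^ D.k C) • (coproduct x (D.q C) ⊗ₜ[ℚ] r C)) = ∑ B ∈ Finset.Icc C D.chords,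
      x ^ (D.k B + kOn (minSides B) B C) • (D.q B ⊗ₜ[ℚ] (midFactor B C ⊗ₜ[ℚ] r C)) := by
    intro C hC
    rw [Finset.mem_powerset] at hC
    rw [coproduct_q x D hC, TensorProduct.sum_tmul, Finset.smul_sum, map_sum]
    refine Finset.sum_congr rfl fun B hB => ?_
    rw [Finset.mem_Icc] at hB
    rw [D.k_eq hC, D.k_eq hB.2, ← kOn_add D.isDissection hB.2 hB.1, pow_add, ← smul_smul,
      ← TensorProduct.smul_tmul', map_smul, map_smul, Algebra.TensorProduct.assoc_tmul]
  have hR : ∀ B ∈ D.chords.powerset, (x ^ D.k B) • (D.q B ⊗ₜ[ℚ] coproduct x (r B)) =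
      ∑ C ∈ B.powerset,
      x ^ (D.k B + kOn (minSides B) B C) • (D.q B ⊗ₜ[ℚ] (midFactor B C ⊗ₜ[ℚ] r C)) := by
    intro B hB
    rw [Finset.mem_powerset] at hB
    rw [coproduct_r x D.isDissection hB, TensorProduct.tmul_sum, Finset.smul_sum]
    refine Finset.sum_congr rfl fun C _ => ?_
    rw [TensorProduct.tmul_smul, smul_smul, pow_add]
  rw [hX]
  simp only [AlgHom.comp_apply, coproduct_toAlg, map_sum, map_smul,
    Algebra.TensorProduct.map_tmul, AlgHom.id_apply]
  simp only [← map_smul]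
  refine (Finset.sum_congr rfl hL).trans (Eq.trans ?_ (Finset.sum_congr rfl hR).symm)
  refine Finset.sum_comm' fun C B => ?_
  simp only [Finset.mem_powerset, Finset.mem_Icc]
  exact ⟨fun h => ⟨h.2.1, h.2.2⟩, fun h => ⟨h.1.trans h.2, h.1, h.2⟩⟩

/-! ## The grading -/

instance grading_gradedMonoid : SetLike.GradedMonoid grading :=
  MvPolynomial.WeightedHomogeneousSubmodule.gradedMonoid

lemma X_mem_grading (D : PosDiagram) : (MvPolynomial.X D : DAlg) ∈ grading D.1.1 :=
  MvPolynomial.isWeightedHomogeneous_X ℚ _ D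

lemma map_chordsToAlg_mem {A : Type*} [CommRing A] [Algebra ℚ A] (𝓑 : ℕ → Submodule ℚ A)
    [SetLike.GradedMonoid 𝓑] (φ : DAlg →ₐ[ℚ] A) (K : Finset (Sym2 (Fin (m + 1))))
    (hφ : ∀ D : PosDiagram, D.1.1 = m → φ (MvPolynomial.X D) ∈ 𝓑 m) :
    φ (chordsToAlg m K) ∈ 𝓑 m := by
  rw [chordsToAlg]
  split_ifs with h
  · rw [Diagram.toAlg]
    split_ifs with h0
    · exact hφ _ rfl
    · obtain rfl : m = 0 := by omega
      rw [map_one]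
      exact SetLike.GradedOne.one_mem
  · rw [map_zero]
    exact zero_mem _

/-- Used for the coproduct and for the antipode, whose homogeneity is thereby reduced to generators.
-/
lemma map_mem_of_mem_grading {A : Type*} [CommRing A] [Algebra ℚ A] (𝓑 : ℕ → Submodule ℚ A)
    [SetLike.GradedMonoid 𝓑] (φ : DAlg →ₐ[ℚ] A)
    (hφ : ∀ D : PosDiagram, φ (MvPolynomial.X D) ∈ 𝓑 D.1.1) {p : DAlg} (hp : p ∈ grading n) :
    φ p ∈ 𝓑 n := by
  rw [grading, MvPolynomial.mem_weightedHomogeneousSubmodule] at hp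
  induction hp using MvPolynomial.IsWeightedHomogeneous.induction_on with
  | zero => rw [map_zero]; exact zero_mem _
  | add p q _ _ h1 h2 => rw [map_add]; exact add_mem h1 h2
  | monomial d c hd =>
    rw [MvPolynomial.monomial_eq, ← MvPolynomial.algebraMap_eq, ← Algebra.smul_def, map_smul,
      Finsupp.prod, map_prod]
    refine Submodule.smul_mem _ _ ?_
    rw [← hd, Finsupp.weight_apply, Finsupp.sum]
    refine SetLike.prod_mem_graded _ _ _ fun D _ => ?_
    rw [map_pow]
    exact SetLike.pow_mem_graded _ (hφ D)

/-- The homogeneous components of `DAlg ⊗ DAlg`. -/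
noncomputable def tensorGrading (n : ℕ) : Submodule ℚ (DAlg ⊗[ℚ] DAlg) :=
  Submodule.span ℚ {t | ∃ i j : ℕ, i + j = n ∧ ∃ a ∈ grading i, ∃ b ∈ grading j, t = a ⊗ₜ[ℚ] b}

lemma tmul_mem_tensorGrading {i j : ℕ} {a b : DAlg} (ha : a ∈ grading i) (hb : b ∈ grading j)
    (h : i + j = n) : a ⊗ₜ[ℚ] b ∈ tensorGrading n :=
  Submodule.subset_span ⟨i, j, h, a, ha, b, hb, rfl⟩

instance tensorGrading_gradedMonoid : SetLike.GradedMonoid tensorGrading where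
  one_mem := by
    rw [Algebra.TensorProduct.one_def]
    exact tmul_mem_tensorGrading SetLike.GradedOne.one_mem SetLike.GradedOne.one_mem rfl
  mul_mem i j s t hs ht := by
    have := Submodule.mul_mem_mul hs ht
    rw [tensorGrading, tensorGrading, Submodule.span_mul_span] at this
    refine Submodule.span_le.mpr ?_ this
    rintro _ ⟨_, ⟨i1, i2, hi, a, ha, b, hb, rfl⟩, _, ⟨j1, j2, hj, a', ha', b', hb', rfl⟩, rfl⟩
    dsimp only
    rw [Algebra.TensorProduct.tmul_mul_tmul]
    exact tmul_mem_tensorGrading (SetLike.GradedMul.mul_mem ha ha')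
      (SetLike.GradedMul.mul_mem hb hb') (by omega)

lemma tensorGrading_le (n : ℕ) : tensorGrading n ≤
    ⨆ p ∈ Finset.HasAntidiagonal.antidiagonal n,
      LinearMap.range (TensorProduct.mapIncl (grading p.1) (grading p.2)) := by
  refine Submodule.span_le.mpr ?_
  rintro _ ⟨i, j, hij, a, ha, b, hb, rfl⟩
  refine Submodule.mem_iSup_of_mem (i, j) (Submodule.mem_iSup_of_mem
    (Finset.HasAntidiagonal.mem_antidiagonal.mpr hij) ?_)
  exact ⟨⟨a, ha⟩ ⊗ₜ[ℚ] ⟨b, hb⟩, rfl⟩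

lemma chordsToAlg_mem_grading (K : Finset (Sym2 (Fin (m + 1)))) : chordsToAlg m K ∈ grading m :=
  map_chordsToAlg_mem grading (AlgHom.id ℚ DAlg) K fun D h => h ▸ X_mem_grading D

lemma sum_faceDegree (D : Diagram n) (hC : C ⊆ D.chords) :
    ∑ i ∈ minSides C, faceDegree C i + C.card = n := (wellDefined D hC).2.2.2

lemma Diagram.q_mem_grading (D : Diagram n) (C : Finset (Sym2 (Fin (n + 1)))) :
    D.q C ∈ grading (∑ i ∈ minSides C, faceDegree C i) :=
  SetLike.prod_mem_graded _ _ _ fun i _ => chordsToAlg_mem_grading (D.qChords C i)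

lemma r_mem_grading (D : Diagram n) (hC : C ⊆ D.chords) : r C ∈ grading C.card := by
  rw [← (wellDefined D hC).1]
  exact chordsToAlg_mem_grading (rChords C)

lemma coproduct_X (x : ℚ) (D : PosDiagram) : coproduct x (MvPolynomial.X D) =
    ∑ C ∈ D.1.2.chords.powerset, (x ^ D.1.2.k C) • (D.1.2.q C ⊗ₜ[ℚ] r C) := by
  rw [coproduct, MvPolynomial.aeval_X]

lemma coproduct_mem (x : ℚ) {p : DAlg} (hp : p ∈ grading n) : coproduct x p ∈ tensorGrading n := by
  refine map_mem_of_mem_grading tensorGrading (coproduct x) (fun D => ?_) hp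
  rw [coproduct_X]
  refine Submodule.sum_mem _ fun C hC => Submodule.smul_mem _ _ ?_
  rw [Finset.mem_powerset] at hC
  exact tmul_mem_tensorGrading (D.1.2.q_mem_grading C) (r_mem_grading D.1.2 hC)
    (sum_faceDegree D.1.2 hC)

/-! ## The counit -/

/-- The augmentation of `DAlg`. -/
noncomputable def counitHom : DAlg →ₐ[ℚ] ℚ := MvPolynomial.aeval 0

lemma counitHom_eq_zero (hn : n ≠ 0) {p : DAlg} (hp : p ∈ grading n) : counitHom p = 0 := by
  rw [counitHom, MvPolynomial.aeval_zero, MvPolynomial.constantCoeff_eq,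
    MvPolynomial.IsWeightedHomogeneous.coeff_eq_zero hp 0 (by simpa using hn.symm), map_zero]

lemma Diagram.q_eq_one_of_eq (D : Diagram n) : D.q D.chords = 1 := by
  have h := sum_faceDegree D subset_rfl
  rw [D.isDissection.card_eq] at h
  refine Finset.prod_eq_one fun i hi => chordsToAlg_eq_one ((wellDefined D subset_rfl).2.2.1 i) ?_
  exact Finset.sum_eq_zero_iff.mp (by omega) i hi

lemma Diagram.aOn_univ (D : Diagram n) : aOn Finset.univ D.chords = D.toAlg := by
  rw [aOn_eq (m := n) (by simp), res_univ D.isDissection.loopless, chordsToAlg,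
    dif_pos D.isDissection]

lemma Diagram.r_chords (D : Diagram n) : r D.chords = D.toAlg := by
  rw [r_eq D.isDissection subset_rfl, ← D.aOn_univ]
  congr 1
  rw [← Finset.card_eq_iff_eq_univ, card_minSides D.isDissection subset_rfl, D.isDissection.card_eq,
    Fintype.card_fin]

lemma Diagram.q_empty (D : Diagram n) : D.q ∅ = D.toAlg := by
  have hs : ∀ i j : Fin (n + 1), SameFace ∅ i j :=
    fun i j a b _ h => absurd h (Finset.notMem_empty _)
  have h1 : minSides (∅ : Finset (Sym2 (Fin (n + 1)))) = {0} := by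
    ext i
    rw [mem_minSides, Finset.mem_singleton]
    exact ⟨fun h => le_antisymm (h 0 (hs i 0)) (Fin.zero_le i), fun h j _ => h ▸ Fin.zero_le j⟩
  have h2 : face (∅ : Finset (Sym2 (Fin (n + 1)))) 0 = Finset.univ := by
    ext i
    simpa [mem_face] using hs 0 i
  rw [D.q_eq (Finset.empty_subset _), h1, Finset.prod_singleton, h2, D.aOn_univ]

lemma Diagram.r_empty (D : Diagram n) : r (∅ : Finset (Sym2 (Fin (n + 1)))) = 1 :=
  have h := wellDefined D (Finset.empty_subset _)
  chordsToAlg_eq_one h.2.1 h.1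

lemma Diagram.k_chords (D : Diagram n) : D.k D.chords = 0 := by
  classical
  rw [D.k_eq subset_rfl, kOn, Finset.card_eq_zero, Finset.filter_eq_empty_iff]
  exact fun c _ h => h.2 h.1

lemma PosDiagram.toAlg_eq (D : PosDiagram) : D.1.2.toAlg = MvPolynomial.X D := by
  rw [Diagram.toAlg, dif_pos D.2]

/-- The degree of `q_C(D)` is `n - |C|`, so only `C = D` survives; the other counit identity keeps
only `C = ∅`. -/
theorem counit_rTensor (x : ℚ) :
    (Algebra.TensorProduct.map counitHom (AlgHom.id ℚ DAlg)).comp (coproduct x) =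
      (Algebra.TensorProduct.lid ℚ DAlg).symm := by
  refine MvPolynomial.algHom_ext fun D => ?_
  have hmem := Finset.mem_powerset.mpr (subset_refl D.1.2.chords)
  rw [AlgHom.comp_apply, coproduct_X, map_sum, Finset.sum_eq_single_of_mem _ hmem]
  · rw [D.1.2.q_eq_one_of_eq, D.1.2.r_chords, D.1.2.k_chords, D.toAlg_eq, pow_zero, one_smul,
      Algebra.TensorProduct.map_tmul, map_one]
    rfl
  · intro C hC hne
    rw [Finset.mem_powerset] at hC
    have h1 := sum_faceDegree D.1.2 hC
    have h2 := Finset.card_lt_card (Finset.ssubset_iff_subset_ne.mpr ⟨hC, hne⟩)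
    rw [D.1.2.isDissection.card_eq] at h2
    rw [map_smul, Algebra.TensorProduct.map_tmul,
      counitHom_eq_zero (by omega) (D.1.2.q_mem_grading C), TensorProduct.zero_tmul, smul_zero]

theorem counit_lTensor (x : ℚ) :
    (Algebra.TensorProduct.map (AlgHom.id ℚ DAlg) counitHom).comp (coproduct x) =
      (Algebra.TensorProduct.rid ℚ ℚ DAlg).symm := by
  refine MvPolynomial.algHom_ext fun D => ?_
  have hmem := Finset.empty_mem_powerset D.1.2.chords
  rw [AlgHom.comp_apply, coproduct_X, map_sum, Finset.sum_eq_single_of_mem _ hmem]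
  · rw [D.1.2.q_empty, D.1.2.r_empty, D.1.2.k_empty, D.toAlg_eq, pow_zero, one_smul,
      Algebra.TensorProduct.map_tmul, map_one]
    rfl
  · intro C hC hne
    rw [Finset.mem_powerset] at hC
    rw [map_smul, Algebra.TensorProduct.map_tmul,
      counitHom_eq_zero (Finset.card_ne_zero.mpr (Finset.nonempty_iff_ne_empty.mpr hne))
        (r_mem_grading D.1.2 hC), TensorProduct.tmul_zero, smul_zero]

/-! ## The antipode -/

/-- Endomorphisms of `DAlg` can be defined on the generators by recursion on the degree. -/
lemma exists_algHom_of_recursion (Φ : (DAlg →ₐ[ℚ] DAlg) → PosDiagram → DAlg)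
    (hΦ : ∀ φ ψ D, (∀ D' : PosDiagram, D'.1.1 < D.1.1 →
      φ (MvPolynomial.X D') = ψ (MvPolynomial.X D')) → Φ φ D = Φ ψ D) :
    ∃ φ : DAlg →ₐ[ℚ] DAlg, ∀ D, φ (MvPolynomial.X D) = Φ φ D := by
  have wf : WellFounded fun D' D : PosDiagram => D'.1.1 < D.1.1 :=
    (measure fun D : PosDiagram => D.1.1).wf
  -- The value `0` in degrees not yet reached is harmless: by `hΦ` the recipe only looks at smaller
  -- degrees.
  let F : ∀ D : PosDiagram, (∀ D' : PosDiagram, D'.1.1 < D.1.1 → DAlg) → DAlg := fun D g =>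
    Φ (MvPolynomial.aeval fun D' => if h : D'.1.1 < D.1.1 then g D' h else 0) D
  refine ⟨MvPolynomial.aeval (wf.fix F), fun D => ?_⟩
  rw [MvPolynomial.aeval_X, wf.fix_eq]
  refine hΦ _ _ D fun D' h => ?_
  rw [MvPolynomial.aeval_X, MvPolynomial.aeval_X, dif_pos h]

lemma algHom_chordsToAlg_congr {φ ψ : DAlg →ₐ[ℚ] DAlg} (K : Finset (Sym2 (Fin (m + 1))))
    (h : ∀ D : PosDiagram, D.1.1 = m → φ (MvPolynomial.X D) = ψ (MvPolynomial.X D)) :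
    φ (chordsToAlg m K) = ψ (chordsToAlg m K) := by
  rw [chordsToAlg]
  split_ifs with hK
  · rw [Diagram.toAlg]
    split_ifs with h0
    · exact h _ rfl
    · rw [map_one, map_one]
  · rw [map_zero, map_zero]

lemma faceDegree_lt (D : Diagram n) (hC : C ⊆ D.chords) (hne : C ≠ ∅) (hi : i ∈ minSides C) :
    faceDegree C i < n := by
  have h1 := sum_faceDegree D hC
  have h2 := Finset.card_pos.mpr (Finset.nonempty_iff_ne_empty.mpr hne)
  have h3 := Finset.single_le_sum (f := faceDegree C) (fun j _ => Nat.zero_le _) hi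
  omega

lemma restDegree_lt (D : Diagram n) (hC : C ⊆ D.chords) (hne : C ≠ D.chords) :
    restDegree C < n := by
  have h2 := Finset.card_lt_card (Finset.ssubset_iff_subset_ne.mpr ⟨hC, hne⟩)
  rw [(wellDefined D hC).1]
  rwa [D.isDissection.card_eq] at h2

/-- The term `C = ∅` is the generator tensor `1`; in all others the factors of `q_C(D)` have degree
less than `n`, so the convolution equation determines the value on each generator recursively. -/
lemma exists_left_antipode (x : ℚ) : ∃ φ : DAlg →ₐ[ℚ] DAlg,
    (∀ D, φ (MvPolynomial.X D) ∈ grading D.1.1) ∧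
    (Algebra.TensorProduct.lmul' ℚ (S := DAlg)).comp
      ((Algebra.TensorProduct.map φ (AlgHom.id ℚ DAlg)).comp (coproduct x)) =
        (Algebra.ofId ℚ DAlg).comp counitHom := by
  classical
  obtain ⟨φ, hφ⟩ := exists_algHom_of_recursion (fun φ D =>
    - ∑ C ∈ D.1.2.chords.powerset.erase ∅, (x ^ D.1.2.k C) • (φ (D.1.2.q C) * r C)) (by
    intro φ ψ D h
    congr 1
    refine Finset.sum_congr rfl fun C hC => ?_
    rw [Finset.mem_erase, Finset.mem_powerset] at hC
    congr 2
    rw [Diagram.q, map_prod, map_prod]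
    refine Finset.prod_congr rfl fun i hi => algHom_chordsToAlg_congr _ fun D' hD' => h D' ?_
    rw [hD']
    exact faceDegree_lt D.1.2 hC.2 hC.1 hi)
  refine ⟨φ, ?_, ?_⟩
  · intro D
    obtain ⟨d, hd⟩ : ∃ d, D.1.1 = d := ⟨_, rfl⟩
    induction d using Nat.strong_induction_on generalizing D with
    | _ d ih =>
      rw [hφ D]
      refine Submodule.neg_mem _ (Submodule.sum_mem _ fun C hC => Submodule.smul_mem _ _ ?_)
      rw [Finset.mem_erase, Finset.mem_powerset] at hC
      have : φ (D.1.2.q C) ∈ grading (∑ i ∈ minSides C, faceDegree C i) := by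
        rw [Diagram.q, map_prod]
        refine SetLike.prod_mem_graded _ _ _ fun i hi => map_chordsToAlg_mem grading φ _ ?_
        intro D' hD'
        rw [← hD']
        exact ih _ (hd ▸ hD' ▸ faceDegree_lt D.1.2 hC.2 hC.1 hi) D' rfl
      have h2 := SetLike.GradedMul.mul_mem this (r_mem_grading D.1.2 hC.2)
      rwa [sum_faceDegree D.1.2 hC.2] at h2
  · refine MvPolynomial.algHom_ext fun D => ?_
    simp only [AlgHom.comp_apply, coproduct_X, map_sum, map_smul, Algebra.TensorProduct.map_tmul,
      AlgHom.id_apply, Algebra.TensorProduct.lmul'_apply_tmul]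
    rw [← Finset.add_sum_erase _ _ (Finset.empty_mem_powerset D.1.2.chords), D.1.2.q_empty,
      D.1.2.r_empty, D.1.2.k_empty, D.toAlg_eq, hφ D, pow_zero, one_smul, mul_one, neg_add_cancel,
      counitHom_eq_zero D.2.ne' (X_mem_grading D), map_zero]

/-- The mirror recursion: now the term `C = D` is isolated, and `r_C(D)` has degree less than `n` in
all others. -/
lemma exists_right_antipode (x : ℚ) : ∃ φ : DAlg →ₐ[ℚ] DAlg,
    (Algebra.TensorProduct.lmul' ℚ (S := DAlg)).comp
      ((Algebra.TensorProduct.map (AlgHom.id ℚ DAlg) φ).comp (coproduct x)) =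
        (Algebra.ofId ℚ DAlg).comp counitHom := by
  classical
  obtain ⟨φ, hφ⟩ := exists_algHom_of_recursion (fun φ D =>
    - ∑ C ∈ D.1.2.chords.powerset.erase D.1.2.chords,
      (x ^ D.1.2.k C) • (D.1.2.q C * φ (r C))) (by
    intro φ ψ D h
    congr 1
    refine Finset.sum_congr rfl fun C hC => ?_
    rw [Finset.mem_erase, Finset.mem_powerset] at hC
    congr 2
    refine algHom_chordsToAlg_congr _ fun D' hD' => h D' ?_
    rw [hD']
    exact restDegree_lt D.1.2 hC.2 hC.1)
  refine ⟨φ, MvPolynomial.algHom_ext fun D => ?_⟩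
  simp only [AlgHom.comp_apply, coproduct_X, map_sum, map_smul, Algebra.TensorProduct.map_tmul,
    AlgHom.id_apply, Algebra.TensorProduct.lmul'_apply_tmul]
  rw [← Finset.add_sum_erase _ _ (Finset.mem_powerset.mpr (subset_refl D.1.2.chords)),
    D.1.2.q_eq_one_of_eq, D.1.2.r_chords, D.1.2.k_chords, D.toAlg_eq, hφ D, pow_zero, one_smul,
    one_mul, neg_add_cancel, counitHom_eq_zero D.2.ne' (X_mem_grading D), map_zero]

/-- A commutative bialgebra is a Hopf algebra as soon as its identity has a left and a right
convolution inverse which are morphisms of algebras. -/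
lemma exists_hopfAlgebra {A : Type} [CommRing A] [Algebra ℚ A] (Δ : A →ₐ[ℚ] A ⊗[ℚ] A)
    (ε : A →ₐ[ℚ] ℚ)
    (coassoc : (Algebra.TensorProduct.assoc ℚ ℚ ℚ A A A).toAlgHom.comp
      ((Algebra.TensorProduct.map Δ (AlgHom.id ℚ A)).comp Δ) =
        (Algebra.TensorProduct.map (AlgHom.id ℚ A) Δ).comp Δ)
    (rTensor_counit : (Algebra.TensorProduct.map ε (AlgHom.id ℚ A)).comp Δ =
      (Algebra.TensorProduct.lid ℚ A).symm)
    (lTensor_counit : (Algebra.TensorProduct.map (AlgHom.id ℚ A) ε).comp Δ =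
      (Algebra.TensorProduct.rid ℚ ℚ A).symm)
    (φ ψ : A →ₐ[ℚ] A)
    (hφ : (Algebra.TensorProduct.lmul' ℚ (S := A)).comp
      ((Algebra.TensorProduct.map φ (AlgHom.id ℚ A)).comp Δ) = (Algebra.ofId ℚ A).comp ε)
    (hψ : (Algebra.TensorProduct.lmul' ℚ (S := A)).comp
      ((Algebra.TensorProduct.map (AlgHom.id ℚ A) ψ).comp Δ) = (Algebra.ofId ℚ A).comp ε) :
    ∃ H : HopfAlgebra ℚ A,
      H.toBialgebra = Bialgebra.ofAlgHom Δ ε coassoc rTensor_counit lTensor_counit ∧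
      ∀ a, H.antipode a = φ a := by
  let bi : Bialgebra ℚ A := Bialgebra.ofAlgHom Δ ε coassoc rTensor_counit lTensor_counit
  have h1 : WithConv.toConv φ * WithConv.toConv (AlgHom.id ℚ A) = 1 :=
    congrArg WithConv.toConv hφ
  have h2 : WithConv.toConv (AlgHom.id ℚ A) * WithConv.toConv ψ = 1 :=
    congrArg WithConv.toConv hψ
  -- In the convolution monoid of algebra endomorphisms, a left inverse equals a right inverse.
  have h3 : φ = ψ := WithConv.toConv_injective (left_inv_eq_right_inv h1 h2)
  subst h3
  refine ⟨{ bi with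
    antipode := φ.toLinearMap
    mul_antipode_rTensor_comul := congrArg AlgHom.toLinearMap hφ
    mul_antipode_lTensor_comul := congrArg AlgHom.toLinearMap hψ }, rfl, fun a => rfl⟩

theorem isGradedConnectedHopfAlgebra (x : ℚ) :
    IsGradedConnectedHopfAlgebra grading (coproduct x) := by
  classical
  obtain ⟨φ, hφ1, hφ⟩ := exists_left_antipode x
  obtain ⟨ψ, hψ⟩ := exists_right_antipode x
  obtain ⟨H, hH, hanti⟩ := exists_hopfAlgebra (coproduct x) counitHom (coproduct_coassoc x)
    (counit_rTensor x) (counit_lTensor x) φ ψ hφ hψ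
  refine ⟨counitHom, coproduct_coassoc x, counit_rTensor x, counit_lTensor x, H, hH,
    ⟨MvPolynomial.weightedGradedAlgebra ℚ _⟩, ?_, ?_, ?_, ?_⟩
  · exact fun n a ha => tensorGrading_le n (coproduct_mem x ha)
  · exact fun n hn a ha => counitHom_eq_zero hn ha
  · intro n a ha
    rw [hanti]
    exact map_mem_of_mem_grading grading φ hφ1 ha
  · refine le_antisymm (fun p hp => ?_) ?_
    -- All generators have positive weight, so the component of degree `0` of a polynomial is its
    -- constant term.
    · have h := MvPolynomial.weightedHomogeneousComponent_zero (R := ℚ)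
        (w := fun D : PosDiagram => D.1.1) p (fun D => D.2.ne')
      rw [MvPolynomial.weightedHomogeneousComponent_eq_self hp] at h
      rw [h, ← MvPolynomial.algebraMap_eq, Algebra.algebraMap_eq_smul_one]
      exact Submodule.smul_mem _ _ (Submodule.mem_span_singleton_self 1)
    · rw [Submodule.span_singleton_le_iff_mem]
      exact SetLike.GradedOne.one_mem

end Dissection

theorem proposition2 :
    -- the operations on dissection diagrams are well defined: for every set `C` of chords of `D`,
    -- `r_C(D)` and all the `q_C^α(D)` are dissection diagrams, of the expected degrees
    (∀ (n : ℕ) (D : Dissection.Diagram n) (C : Finset (Sym2 (Fin (n + 1)))), C ⊆ D.chords →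
      Dissection.restDegree C = C.card ∧
      Dissection.IsDissection (Dissection.restDegree C) (Dissection.rChords C) ∧
      (∀ i : Fin (n + 1),
        Dissection.IsDissection (Dissection.faceDegree C i) (D.qChords C i)) ∧
      ∑ i ∈ Dissection.minSides C, Dissection.faceDegree C i + C.card = n) ∧
    -- the Hopf algebra of dissection diagrams
    Dissection.IsGradedConnectedHopfAlgebra Dissection.grading (Dissection.coproduct (-1)) ∧
    -- the variants with a rational parameter
    ∀ x : ℚ, Dissection.IsGradedConnectedHopfAlgebra Dissection.grading
      (Dissection.coproduct x) :=
  ⟨fun _ D _ hC => Dissection.wellDefined D hC, Dissection.isGradedConnectedHopfAlgebra (-1),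
    Dissection.isGradedConnectedHopfAlgebra⟩
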